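/- Setting. Let $X_1,X_2,\dots$ be i.i.d. observations with distribution $\mu$, let $g(x,\theta)\in\mathbb R^m$ be a moment function of $\theta\in\Theta\subset\mathbb R^p$, let $G(x,\theta)=\partial g(x,\theta)/\partial\theta'$ ($m\times p$) and $F(x,\theta)=\partial\,\mathrm{vec}(G(x,\theta)')/\partial\theta'$ ($mp\times p$), and write $g(\theta),G(\theta),F(\theta)$ for their expectations under $\mu$. Put $$\psi(x,\theta)=\begin{bmatrix}g(x,\theta)\\ \mathrm{vec}(G(x,\theta)')\end{bmatrix},\qquad \Gamma(\theta)=E\Big[\frac{\partial\psi(X,\theta)}{\partial\theta'}\Big]=\begin{bmatrix}G(\theta)\\F(\theta)\end{bmatrix},\qquad \Sigma(\theta)=E[\psi(X,\theta)\psi(X,\theta)']-E[\psi(X,\theta)]E[\psi(X,\theta)]'.$$ Assume that: $\Theta$ is compact; $W$ is symmetric positive definite; $\theta\mapsto g(\theta)'Wg(\theta)$ has a unique minimizer $\theta_W$ over $\Theta$, and $\theta_W$ is an interior point of $\Theta$; $g(\theta)\neq0$ for all $\theta\in\Theta$; with probability one $g(X,\cdot)$ is twice continuously differentiable on a fixed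 open neighbourhood of $\Theta$; the expectations $E\sup_{\theta\in\Theta}\|g(X,\theta)\|$, $E\sup_{\theta\in\Theta}\|G(X,\theta)\|$, $E\sup_{\theta\in\Theta}\|F(X,\theta)\|$, $E\|g(X,\theta_W)\|^2$ and $E\|G(X,\theta_W)\|^2$ are finite. Let $\widetilde\psi(x,\theta)=\psi(x,\theta)-E[\psi(X,\theta_W)]$ and $\widetilde\psi_n(\theta)=n^{-1}\sum_{i=1}^n\widetilde\psi(X_i,\theta)$. Call a $p\times m(p+1)$ matrix $\Lambda$ admissible if $\Lambda E[\widetilde\psi(X,\theta)]\neq0$ for all $\theta\in\Theta$ with $\theta\ne\theta_W$, and $\Lambda\Gamma(\theta_W)$ is nonsingular. For $\Lambda\Gamma(\theta_W)$ nonsingular put $$V_M(\Lambda)=(\Lambda\Gamma(\theta_W))^{-1}\Lambda\Sigma(\theta_W)\Lambda'((\Lambda\Gamma(\theta_W))')^{-1}.$$ Suppose that $\Sigma(\theta_W)$ is nonsingular and that $\Lambda^*=\Gamma(\theta_W)'\Sigma(\theta_W)^{-1}$ is admissible. A misspecification-efficient (ME) estimator is a measurable sequence $\widehat\theta_n$ which,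 with probability tending to one, lies in $\Theta$ and satisfies $\widehat\Lambda_n\widetilde\psi_n(\widehat\theta_n)=0$, where $\widehat\Lambda_n=\Lambda^*$ or, more generally, $\widehat\Lambda_n\to\Lambda^*$ in probability. Statement. Let $V_{ME}(W)=(\Gamma(\theta_W)'\Sigma(\theta_W)^{-1}\Gamma(\theta_W))^{-1}$, a positive definite matrix. (i) For every ME estimator, $\sqrt n(\widehat\theta_n-\theta_W)\to N(0,V_{ME}(W))$ in distribution. (ii) $V_M(\Lambda)-V_{ME}(W)$ is positive semidefinite for every admissible $\Lambda$. (iii) In particular, let $A=[\,G(\theta_W)'W\quad g(\theta_W)'W\otimes I_p\,]$. If $A\Gamma(\theta_W)$ is nonsingular, then $V_{GMM}(W)-V_{ME}(W)$ is positive semidefinite, where $V_{GMM}(W)=V_M(A)$. (iv) Write $\Sigma(\theta_W)=\begin{bmatrix}\Sigma_{11}&\Sigma_{12}\\ \Sigma_{21}&\Sigma_{22}\end{bmatrix}$ with $\Sigma_{11}$ of size $m\times m$, $\Sigma_{22,1}=\Sigma_{22}-\Sigma_{21}\Sigma_{11}^{-1}\Sigma_{12}$ and $F_G=F(\theta_W)-\Sigma_{21}\Sigma_{11}^{-1}G(\theta_W)$.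 Then $\Sigma_{11}$ and $\Sigma_{22,1}$ are nonsingular and $$V_{ME}(W)=\big(G(\theta_W)'\Sigma_{11}^{-1}G(\theta_W)+F_G'\Sigma_{22,1}^{-1}F_G\big)^{-1}.$$ -/

import Mathlib

open MeasureTheory ProbabilityTheory Filter Topology Matrix

namespace MisspecGMM

noncomputable section

/-- The space `ℝ^k` with its Euclidean norm. -/
abbrev Vec (k : ℕ) : Type := EuclideanSpace ℝ (Fin k)

/-- Indices of the augmented moment vector `ψ = (g, vec(G'))`, which has `m + m p` components.
The index `(i, k)` of the second block is the position of `∂ gᵢ / ∂ θₖ` in `vec(G')`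
(the columns of `G'`, that is the rows of `G`, stacked). -/
abbrev AugIdx (m p : ℕ) : Type := Fin m ⊕ (Fin m × Fin p)

variable {Ω 𝒳 : Type*} [MeasurableSpace Ω] [MeasurableSpace 𝒳] {m p : ℕ}

/-! ### Moment function, its Jacobian and its curvature at one observation -/

/-- The Jacobian `G(x, θ) = ∂ g(x, θ) / ∂ θ'`, an `m × p` matrix. -/
def jac (g : 𝒳 → Vec p → Vec m) (x : 𝒳) (θ : Vec p) : Matrix (Fin m) (Fin p) ℝ :=
  Matrix.of fun i k => fderiv ℝ (fun t => g x t i) θ (EuclideanSpace.single k 1)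

/-- The curvature `F(x, θ) = ∂ vec(G(x, θ)') / ∂ θ'`, an `m p × p` matrix. -/
def curv (g : 𝒳 → Vec p → Vec m) (x : 𝒳) (θ : Vec p) : Matrix (Fin m × Fin p) (Fin p) ℝ :=
  Matrix.of fun ik l => fderiv ℝ (fun t => jac g x t ik.1 ik.2) θ (EuclideanSpace.single l 1)

/-- The augmented moments `ψ(x, θ) = (g(x, θ), vec(G(x, θ)'))`. -/
def psi (g : 𝒳 → Vec p → Vec m) (x : 𝒳) (θ : Vec p) : AugIdx m p → ℝ :=
  Sum.elim (fun i => g x θ i) (fun ik => jac g x θ ik.1 ik.2)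

/-! ### Population quantities, for an observation with distribution `μ` -/

/-- `g(θ) = E[g(X, θ)]`. -/
def gPop (μ : Measure 𝒳) (g : 𝒳 → Vec p → Vec m) (θ : Vec p) : Fin m → ℝ :=
  fun i => ∫ x, g x θ i ∂μ

/-- `G(θ) = E[G(X, θ)]`. -/
def GPop (μ : Measure 𝒳) (g : 𝒳 → Vec p → Vec m) (θ : Vec p) : Matrix (Fin m) (Fin p) ℝ :=
  Matrix.of fun i k => ∫ x, jac g x θ i k ∂μ

/-- `F(θ) = E[F(X, θ)]`. -/
def FPop (μ : Measure 𝒳) (g : 𝒳 → Vec p → Vec m) (θ : Vec p) :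
    Matrix (Fin m × Fin p) (Fin p) ℝ :=
  Matrix.of fun ik l => ∫ x, curv g x θ ik l ∂μ

/-- `Γ(θ) = E[∂ ψ(X, θ) / ∂ θ']`, that is `G(θ)` stacked over `F(θ)`. -/
def Gam (μ : Measure 𝒳) (g : 𝒳 → Vec p → Vec m) (θ : Vec p) :
    Matrix (AugIdx m p) (Fin p) ℝ :=
  Matrix.fromRows (GPop μ g θ) (FPop μ g θ)

/-- `E[ψ(X, θ)]`. -/
def psiPop (μ : Measure 𝒳) (g : 𝒳 → Vec p → Vec m) (θ : Vec p) : AugIdx m p → ℝ :=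
  fun a => ∫ x, psi g x θ a ∂μ

/-- `Σ(θ) = E[ψ(X, θ) ψ(X, θ)'] - E[ψ(X, θ)] E[ψ(X, θ)]'`. -/
def Sig (μ : Measure 𝒳) (g : 𝒳 → Vec p → Vec m) (θ : Vec p) :
    Matrix (AugIdx m p) (AugIdx m p) ℝ :=
  Matrix.of fun a b => (∫ x, psi g x θ a * psi g x θ b ∂μ) - psiPop μ g θ a * psiPop μ g θ b

/-- The recentred augmented moments `ψ̃(x, θ) = ψ(x, θ) - E[ψ(X, θ_W)]`. -/
def psiTilde (μ : Measure 𝒳) (g : 𝒳 → Vec p → Vec m) (θW : Vec p) (x : 𝒳) (θ : Vec p) :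
    AugIdx m p → ℝ :=
  psi g x θ - psiPop μ g θW

/-- `E[ψ̃(X, θ)]`. -/
def psiTildePop (μ : Measure 𝒳) (g : 𝒳 → Vec p → Vec m) (θW θ : Vec p) : AugIdx m p → ℝ :=
  fun a => ∫ x, psiTilde μ g θW x θ a ∂μ

/-- The population GMM criterion `g(θ)' W g(θ)`. -/
def gmmCriterion (μ : Measure 𝒳) (g : 𝒳 → Vec p → Vec m) (W : Matrix (Fin m) (Fin m) ℝ)
    (θ : Vec p) : ℝ :=
  gPop μ g θ ⬝ᵥ (W *ᵥ gPop μ g θ)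

/-! ### Sampling and regularity assumptions -/

/-- `θW` is the unique minimizer over `Θ` of the population GMM criterion. -/
def IsPseudoTrue (μ : Measure 𝒳) (g : 𝒳 → Vec p → Vec m) (W : Matrix (Fin m) (Fin m) ℝ)
    (Θ : Set (Vec p)) (θW : Vec p) : Prop :=
  θW ∈ Θ ∧ ∀ θ ∈ Θ, θ ≠ θW → gmmCriterion μ g W θW < gmmCriterion μ g W θ

open scoped Matrix.Norms.L2Operator in
/-- The assumptions that do not involve the choice of `Λ`. Norms of vectors are Euclidean, norms
of matrices are spectral. -/
structure Regular (P : Measure Ω) (μ : Measure 𝒳) (X : ℕ → Ω → 𝒳) (g : 𝒳 → Vec p → Vec m)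
    (W : Matrix (Fin m) (Fin m) ℝ) (Θ : Set (Vec p)) (θW : Vec p) : Prop where
  /-- The observations are independent ... -/
  indep : iIndepFun X P
  /-- ... with the common distribution `μ`. -/
  law : ∀ i, HasLaw (X i) μ P
  /-- The weighting matrix is (symmetric and) positive definite. -/
  weight : W.PosDef
  /-- The parameter space is compact. -/
  compact : IsCompact Θ
  /-- The pseudo-true value exists and is unique ... -/
  pseudoTrue : IsPseudoTrue μ g W Θ θW
  /-- ... and is an interior point of the parameter space. -/
  interior : θW ∈ interior Θ
  /-- Global misspecification. -/
  misspec : ∀ θ ∈ Θ, gPop μ g θ ≠ 0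
  /-- Near the parameter space, `g(x, θ)` is measurable in `x` and, with probability one, twice
  continuously differentiable in `θ`. -/
  smooth : ∃ U : Set (Vec p), IsOpen U ∧ Θ ⊆ U ∧ (∀ θ ∈ U, Measurable fun x => g x θ) ∧
    ∀ᵐ x ∂μ, ContDiffOn ℝ 2 (g x) U
  sup_g : ∫⁻ x, ⨆ θ ∈ Θ, ‖g x θ‖ₑ ∂μ < ⊤
  sup_G : ∫⁻ x, ⨆ θ ∈ Θ, ‖jac g x θ‖ₑ ∂μ < ⊤
  sup_F : ∫⁻ x, ⨆ θ ∈ Θ, ‖curv g x θ‖ₑ ∂μ < ⊤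
  sq_g : ∫⁻ x, ‖g x θW‖ₑ ^ 2 ∂μ < ⊤
  sq_G : ∫⁻ x, ‖jac g x θW‖ₑ ^ 2 ∂μ < ⊤

/-- The assumptions on `Λ`: it identifies `θW`, and `Λ Γ(θ_W)` is nonsingular. -/
structure Admissible (μ : Measure 𝒳) (g : 𝒳 → Vec p → Vec m) (Θ : Set (Vec p)) (θW : Vec p)
    (L : Matrix (Fin p) (AugIdx m p) ℝ) : Prop where
  ident : ∀ θ ∈ Θ, θ ≠ θW → L *ᵥ psiTildePop μ g θW θ ≠ 0
  nonsing : IsUnit (L * Gam μ g θW).det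

/-! ### Estimators -/

/-- `ψ̃ₙ(θ) = n⁻¹ ∑ ψ̃(Xᵢ, θ)`, the sum being over the first `n` observations. -/
def psiTildeBar (μ : Measure 𝒳) (g : 𝒳 → Vec p → Vec m) (θW : Vec p) (X : ℕ → Ω → 𝒳)
    (n : ℕ) (ω : Ω) (θ : Vec p) : AugIdx m p → ℝ :=
  (n : ℝ)⁻¹ • ∑ i ∈ Finset.range n, psiTilde μ g θW (X i ω) θ

/-- `θhat` is an M-estimator `θ̃(Λ)` built with a consistent estimator `Lhat` of `Λ` (which may
be `Λ` itself, at every `n`): with probability tending to one, `θhat n` is a point of `Θ` that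
solves the sample equation `Λ̂ₙ ψ̃ₙ(θ) = 0`. -/
structure IsMEstimator (P : Measure Ω) (μ : Measure 𝒳) (X : ℕ → Ω → 𝒳)
    (g : 𝒳 → Vec p → Vec m) (Θ : Set (Vec p)) (θW : Vec p)
    (L : Matrix (Fin p) (AugIdx m p) ℝ) (Lhat : ℕ → Ω → Matrix (Fin p) (AugIdx m p) ℝ)
    (θhat : ℕ → Ω → Vec p) : Prop where
  aemeasurable : ∀ n, AEMeasurable (θhat n) P
  consistent : ∀ k a, TendstoInMeasure P (fun n ω => Lhat n ω k a) atTop (fun _ => L k a)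
  solves : Tendsto (fun n => P {ω | ¬ (θhat n ω ∈ Θ ∧
    Lhat n ω *ᵥ psiTildeBar μ g θW X n ω (θhat n ω) = 0)}) atTop (𝓝 0)

/-! ### Choices of `Λ` and asymptotic variances -/

/-- `Λ* = Γ(θ)' Σ(θ)⁻¹`. -/
def LamStar (μ : Measure 𝒳) (g : 𝒳 → Vec p → Vec m) (θ : Vec p) :
    Matrix (Fin p) (AugIdx m p) ℝ :=
  (Gam μ g θ)ᵀ * (Sig μ g θ)⁻¹

/-- `A(W, θ) = [G(θ)' W, g(θ)' W ⊗ I_p]`, the choice of `Λ` that gives the GMM estimator. -/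
def AGmm (μ : Measure 𝒳) (g : 𝒳 → Vec p → Vec m) (W : Matrix (Fin m) (Fin m) ℝ) (θ : Vec p) :
    Matrix (Fin p) (AugIdx m p) ℝ :=
  Matrix.fromCols ((GPop μ g θ)ᵀ * W)
    (Matrix.of fun k il => (gPop μ g θ ᵥ* W) il.1 * (1 : Matrix (Fin p) (Fin p) ℝ) k il.2)

/-- `V_M(Λ, θ) = (Λ Γ)⁻¹ Λ Σ Λ' ((Λ Γ)')⁻¹`. -/
def VM (μ : Measure 𝒳) (g : 𝒳 → Vec p → Vec m) (θ : Vec p)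
    (L : Matrix (Fin p) (AugIdx m p) ℝ) : Matrix (Fin p) (Fin p) ℝ :=
  (L * Gam μ g θ)⁻¹ * L * Sig μ g θ * Lᵀ * ((L * Gam μ g θ)ᵀ)⁻¹

/-- `V_GMM(W, θ) = (A Γ)⁻¹ A Σ A' ((A Γ)')⁻¹` with `A = A(W, θ)`. -/
def VGMM (μ : Measure 𝒳) (g : 𝒳 → Vec p → Vec m) (W : Matrix (Fin m) (Fin m) ℝ) (θ : Vec p) :
    Matrix (Fin p) (Fin p) ℝ :=
  VM μ g θ (AGmm μ g W θ)

/-- `V_ME = (Γ' Σ⁻¹ Γ)⁻¹`. -/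
def VME (μ : Measure 𝒳) (g : 𝒳 → Vec p → Vec m) (θ : Vec p) : Matrix (Fin p) (Fin p) ℝ :=
  ((Gam μ g θ)ᵀ * (Sig μ g θ)⁻¹ * Gam μ g θ)⁻¹

/-! ### Blocks of `Σ(θ)` -/

def Sig11 (μ : Measure 𝒳) (g : 𝒳 → Vec p → Vec m) (θ : Vec p) :
    Matrix (Fin m) (Fin m) ℝ := (Sig μ g θ).toBlocks₁₁

def Sig12 (μ : Measure 𝒳) (g : 𝒳 → Vec p → Vec m) (θ : Vec p) :
    Matrix (Fin m) (Fin m × Fin p) ℝ := (Sig μ g θ).toBlocks₁₂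

def Sig21 (μ : Measure 𝒳) (g : 𝒳 → Vec p → Vec m) (θ : Vec p) :
    Matrix (Fin m × Fin p) (Fin m) ℝ := (Sig μ g θ).toBlocks₂₁

def Sig22 (μ : Measure 𝒳) (g : 𝒳 → Vec p → Vec m) (θ : Vec p) :
    Matrix (Fin m × Fin p) (Fin m × Fin p) ℝ := (Sig μ g θ).toBlocks₂₂

/-- `Σ₂₂.₁ = Σ₂₂ - Σ₂₁ Σ₁₁⁻¹ Σ₁₂`. -/
def Sig22dot1 (μ : Measure 𝒳) (g : 𝒳 → Vec p → Vec m) (θ : Vec p) :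
    Matrix (Fin m × Fin p) (Fin m × Fin p) ℝ :=
  Sig22 μ g θ - Sig21 μ g θ * (Sig11 μ g θ)⁻¹ * Sig12 μ g θ

/-- `F_G(θ) = F(θ) - Σ₂₁ Σ₁₁⁻¹ G(θ)`. -/
def FG (μ : Measure 𝒳) (g : 𝒳 → Vec p → Vec m) (θ : Vec p) :
    Matrix (Fin m × Fin p) (Fin p) ℝ :=
  FPop μ g θ - Sig21 μ g θ * (Sig11 μ g θ)⁻¹ * GPop μ g θ

end

end MisspecGMM

namespace MisspecGMM

/-! ### Matrix algebra -/

section MatrixAlgebra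

variable {ι κ ι₁ ι₂ : Type*} [Fintype ι] [Fintype ι₁] [Fintype ι₂]
  [DecidableEq ι] [DecidableEq ι₁] [DecidableEq ι₂]

/-! Everything rests on the matrix `K = (ΛΓ)⁻¹Λ`, a left inverse of `Γ`. The influence function of
the estimator built on `Λ` is `-K ψ̃(x, θW)`, so its asymptotic variance is `K Σ K'`. Among left
inverses of `Γ` this is smallest at `K* = (Γ'Σ⁻¹Γ)⁻¹Γ'Σ⁻¹`, because the excess is `(K - K*) Σ (K -
K*)'` (`posSemidef_sandwich_sub`). The choice `Λ = Λ*` gives `K*` (`VM_LamStar`), and block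
elimination of `Σ` gives the partitioned formula. As a covariance matrix, `Σ` is positive
semidefinite, hence positive definite once nonsingular.

Asymptotic normality is proved for every admissible `Λ`. The probabilistic core is the local uniform
law of large numbers `wpa_avg_le_near`, used twice. Applied to increments of `ψ`, together with
compactness of `Θ` and identification, it gives consistency (`IsMEstimator.wpa_dist_lt`). Applied to
the normalized Taylor remainder of `ψ` at `θW`, it gives a linearization of the sample moments with
error `η ‖θ - θW‖` (`Regular.wpa_psiTildeBar_linearize`); differentiability and a bound on the first
derivative of `ψ` suffice.

A deterministic perturbation argument (`exists_norm_add_le_of_approx_linear`) turns the estimating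
equation into `θ̂ - θW = -K ψ̃ₙ(θW)` up to a small multiple of `‖ψ̃ₙ(θW)‖`. Since `√n ψ̃ₙ(θW)` is
tight by Chebyshev, the error is negligible after scaling, and the central limit theorem with
Slutsky's lemma concludes. -/

theorem posDef_transpose_mul_inv_mul [Fintype κ] [DecidableEq κ] {S : Matrix ι ι ℝ}
    (hS : S.PosDef) {Γ : Matrix ι κ ℝ} {L : Matrix κ ι ℝ} (hL : IsUnit (L * Γ).det) :
    (Γᵀ * S⁻¹ * Γ).PosDef := by
  have h : Function.Injective Γ.mulVec := by
    -- `(LΓ)⁻¹L` is a left inverse of `Γ`, so `Γ` has full column rank.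
    refine Function.LeftInverse.injective (g := fun v => ((L * Γ)⁻¹ * L) *ᵥ v) fun v => ?_
    simp [Matrix.mulVec_mulVec, Matrix.mul_assoc, Matrix.nonsing_inv_mul _ hL]
  simpa [conjTranspose_eq_transpose_of_trivial] using hS.inv.conjTranspose_mul_mul_same h

/-- The Gauss–Markov inequality. -/
theorem posSemidef_sandwich_sub [Fintype κ] [DecidableEq κ] {S : Matrix ι ι ℝ}
    (hS : S.PosDef) {Γ : Matrix ι κ ℝ} {L : Matrix κ ι ℝ} (hL : IsUnit (L * Γ).det) :
    ((L * Γ)⁻¹ * L * S * Lᵀ * ((L * Γ)ᵀ)⁻¹ - (Γᵀ * S⁻¹ * Γ)⁻¹).PosSemidef := by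
  have hV := posDef_transpose_mul_inv_mul hS hL
  have hSu : IsUnit S.det := (Matrix.isUnit_iff_isUnit_det S).1 hS.isUnit
  have hVu := (Matrix.isUnit_iff_isUnit_det _).1 hV.isUnit
  have hSt : Sᵀ = S := by
    simpa [IsHermitian, conjTranspose_eq_transpose_of_trivial] using hS.isHermitian
  set N := Γᵀ * S⁻¹ * Γ with hN
  have hNt : (N⁻¹)ᵀ = N⁻¹ := by
    simpa [IsHermitian, conjTranspose_eq_transpose_of_trivial] using hV.inv.isHermitian
  set K := (L * Γ)⁻¹ * L with hK
  have hKΓ : K * Γ = 1 := by rw [hK, Matrix.mul_assoc, Matrix.nonsing_inv_mul _ hL]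
  have hΓK : Γᵀ * Kᵀ = 1 := by rw [← Matrix.transpose_mul, hKΓ, Matrix.transpose_one]
  have hKt : Lᵀ * ((L * Γ)ᵀ)⁻¹ = Kᵀ := by
    rw [hK, Matrix.transpose_mul (L * Γ)⁻¹ L, Matrix.transpose_nonsing_inv]
  -- Completing the square: `K` and `N⁻¹Γ'S⁻¹` are both left inverses of `Γ`, so the cross terms and
  -- the second square all equal `N⁻¹`.
  have key : K * S * Lᵀ * ((L * Γ)ᵀ)⁻¹ - N⁻¹
      = (K - N⁻¹ * Γᵀ * S⁻¹) * S * (K - N⁻¹ * Γᵀ * S⁻¹)ᵀ := by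
    have e1 : (K - N⁻¹ * Γᵀ * S⁻¹) * S = K * S - N⁻¹ * Γᵀ := by
      rw [Matrix.sub_mul, Matrix.mul_assoc (N⁻¹ * Γᵀ), Matrix.nonsing_inv_mul _ hSu,
        Matrix.mul_one]
    have e2 : (K - N⁻¹ * Γᵀ * S⁻¹)ᵀ = Kᵀ - S⁻¹ * Γ * N⁻¹ := by
      rw [Matrix.transpose_sub, Matrix.transpose_mul _ S⁻¹, Matrix.transpose_mul N⁻¹, hNt,
        Matrix.transpose_transpose, Matrix.transpose_nonsing_inv, hSt, Matrix.mul_assoc]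
    have e3 : K * S * (S⁻¹ * Γ * N⁻¹) = N⁻¹ := by
      calc K * S * (S⁻¹ * Γ * N⁻¹) = K * (S * S⁻¹) * Γ * N⁻¹ := by simp only [Matrix.mul_assoc]
        _ = N⁻¹ := by rw [Matrix.mul_nonsing_inv _ hSu, Matrix.mul_one, hKΓ, Matrix.one_mul]
    have e4 : N⁻¹ * Γᵀ * Kᵀ = N⁻¹ := by rw [Matrix.mul_assoc, hΓK, Matrix.mul_one]
    have e5 : N⁻¹ * Γᵀ * (S⁻¹ * Γ * N⁻¹) = N⁻¹ := by
      calc N⁻¹ * Γᵀ * (S⁻¹ * Γ * N⁻¹) = N⁻¹ * N * N⁻¹ := by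
            rw [hN]; simp only [Matrix.mul_assoc]
        _ = N⁻¹ := by rw [Matrix.nonsing_inv_mul _ hVu, Matrix.one_mul]
    rw [e1, e2, Matrix.sub_mul, Matrix.mul_sub, Matrix.mul_sub, e3, e4, e5, sub_self, sub_zero,
      Matrix.mul_assoc (K * S), hKt]
  rw [key]
  simpa [conjTranspose_eq_transpose_of_trivial] using
    hS.posSemidef.mul_mul_conjTranspose_same (K - N⁻¹ * Γᵀ * S⁻¹)

theorem isUnit_det_schurComplement {A : Matrix ι₁ ι₁ ℝ} {B : Matrix ι₁ ι₂ ℝ} {C : Matrix ι₂ ι₁ ℝ}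
    {D : Matrix ι₂ ι₂ ℝ} (hA : IsUnit A.det) (h : IsUnit (fromBlocks A B C D).det) :
    IsUnit (D - C * A⁻¹ * B).det := by
  have := A.invertibleOfIsUnitDet hA
  rw [det_fromBlocks₁₁, invOf_eq_nonsing_inv] at h
  exact isUnit_of_mul_isUnit_right h

/-- The quadratic form of the inverse of a symmetric partitioned matrix. -/
theorem fromRows_transpose_mul_inv_fromBlocks_mul {A : Matrix ι₁ ι₁ ℝ} {B : Matrix ι₁ ι₂ ℝ}
    {C : Matrix ι₂ ι₁ ℝ} {D : Matrix ι₂ ι₂ ℝ} (hA : IsUnit A.det) (hAt : Aᵀ = A) (hBC : Bᵀ = C)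
    (hD : IsUnit (D - C * A⁻¹ * B).det) (G : Matrix ι₁ κ ℝ) (F : Matrix ι₂ κ ℝ) :
    (fromRows G F)ᵀ * (fromBlocks A B C D)⁻¹ * fromRows G F =
      Gᵀ * A⁻¹ * G + (F - C * A⁻¹ * G)ᵀ * (D - C * A⁻¹ * B)⁻¹ * (F - C * A⁻¹ * G) := by
  set E := D - C * A⁻¹ * B with hE
  have hAit : (A⁻¹)ᵀ = A⁻¹ := by rw [Matrix.transpose_nonsing_inv, hAt]
  -- Block elimination: congruence by `U` turns the partitioned matrix into `diag(A, E)`, with `E`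
  -- the Schur complement.
  set U : Matrix (ι₁ ⊕ ι₂) (ι₁ ⊕ ι₂) ℝ := fromBlocks 1 0 (-(C * A⁻¹)) 1 with hU
  have hinv : (fromBlocks A B C D)⁻¹ = Uᵀ * fromBlocks A⁻¹ 0 0 E⁻¹ * U := by
    refine Matrix.inv_eq_right_inv ?_
    have h1 : U * fromBlocks A B C D * Uᵀ = fromBlocks A 0 0 E := by
      have h2 : A * (A⁻¹ * B) = B := Matrix.mul_nonsing_inv_cancel_left _ _ hA
      have h3 : C * A⁻¹ * A = C := Matrix.nonsing_inv_mul_cancel_right _ _ hA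
      have h4 : (C * A⁻¹)ᵀ = A⁻¹ * B := by
        rw [Matrix.transpose_mul, hAit, ← hBC, Matrix.transpose_transpose]
      simp only [hU, fromBlocks_transpose, fromBlocks_multiply, Matrix.transpose_neg, h4]
      simp [h2, h3, hE]
      abel
    have hUu : IsUnit U.det := by simp [hU]
    have hUtu : IsUnit Uᵀ.det := by rwa [Matrix.det_transpose]
    have h5 : fromBlocks A 0 0 E * fromBlocks A⁻¹ 0 0 E⁻¹ = 1 := by
      simp [fromBlocks_multiply, Matrix.mul_nonsing_inv _ hA, Matrix.mul_nonsing_inv _ hD]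
    calc fromBlocks A B C D * (Uᵀ * fromBlocks A⁻¹ 0 0 E⁻¹ * U)
        = U⁻¹ * (U * fromBlocks A B C D * Uᵀ) * fromBlocks A⁻¹ 0 0 E⁻¹ * U := by
          simp only [Matrix.mul_assoc]
          rw [Matrix.nonsing_inv_mul_cancel_left _ _ hUu]
      _ = 1 := by
          rw [h1, Matrix.mul_assoc U⁻¹, h5, Matrix.mul_one, Matrix.nonsing_inv_mul _ hUu]
  have hUG : U * fromRows G F = fromRows G (F - C * A⁻¹ * G) := by
    rw [hU, fromBlocks_mul_fromRows]
    simp [sub_eq_neg_add]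
  calc (fromRows G F)ᵀ * (fromBlocks A B C D)⁻¹ * fromRows G F
      = (U * fromRows G F)ᵀ * fromBlocks A⁻¹ 0 0 E⁻¹ * (U * fromRows G F) := by
        rw [hinv, Matrix.transpose_mul]; simp only [Matrix.mul_assoc]
    _ = _ := by
        rw [hUG, transpose_fromRows, fromCols_mul_fromBlocks, fromCols_mul_fromRows]
        simp

end MatrixAlgebra


/-! ### Events whose probability tends to one -/

section Wpa

variable {Ω : Type*} [MeasurableSpace Ω]

/-- The event `Q n` has probability tending to one: its complement has vanishing outer measure. -/
def Wpa (P : Measure Ω) (Q : ℕ → Ω → Prop) : Prop :=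
  Tendsto (fun n => P {ω | ¬ Q n ω}) atTop (𝓝 0)

variable {P : Measure Ω} {Q R : ℕ → Ω → Prop}

theorem Wpa.mono (h : Wpa P Q) (hQR : ∀ n ω, Q n ω → R n ω) : Wpa P R :=
  tendsto_of_tendsto_of_tendsto_of_le_of_le tendsto_const_nhds h (fun _ => zero_le)
    fun n => measure_mono fun ω hω hQ => hω (hQR n ω hQ)

theorem Wpa.and (h : Wpa P Q) (h' : Wpa P R) : Wpa P fun n ω => Q n ω ∧ R n ω := by
  have h0 : Tendsto (fun n => P {ω | ¬ Q n ω} + P {ω | ¬ R n ω}) atTop (𝓝 0) := by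
    simpa using Tendsto.add h h'
  refine tendsto_of_tendsto_of_tendsto_of_le_of_le tendsto_const_nhds h0 (fun _ => zero_le)
    fun n => (measure_mono fun ω hω => ?_).trans (measure_union_le _ _)
  simpa [imp_iff_not_or] using hω

theorem Wpa.of_ae (h : ∀ᵐ ω ∂P, ∀ n, Q n ω) : Wpa P Q := by
  have : ∀ n, P {ω | ¬ Q n ω} = 0 := fun n => ae_iff.1 (h.mono fun ω hω => hω n)
  simp [Wpa, this]

theorem Wpa.forall_finset {ι : Type*} (s : Finset ι) {Q : ι → ℕ → Ω → Prop}
    (h : ∀ i ∈ s, Wpa P (Q i)) : Wpa P fun n ω => ∀ i ∈ s, Q i n ω := by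
  classical
  induction s using Finset.induction_on with
  | empty => exact Wpa.of_ae (by simp)
  | insert i s hi ih =>
    refine ((h i (by simp)).and (ih fun j hj => h j (by simp [hj]))).mono ?_
    intro n ω hω j hj
    rcases Finset.mem_insert.1 hj with rfl | hj
    exacts [hω.1, hω.2 j hj]

theorem Wpa.forall {ι : Type*} [Fintype ι] {Q : ι → ℕ → Ω → Prop} (h : ∀ i, Wpa P (Q i)) :
    Wpa P fun n ω => ∀ i, Q i n ω :=
  (Wpa.forall_finset Finset.univ fun i _ => h i).mono fun _ _ hω i => hω i (Finset.mem_univ i)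

theorem Wpa.of_tendstoInMeasure {f : ℕ → Ω → ℝ} {c : ℝ}
    (h : TendstoInMeasure P f atTop fun _ => c) {ε : ℝ} (hε : 0 < ε) :
    Wpa P fun n ω => |f n ω - c| < ε := by
  simpa [Wpa, not_lt, Real.norm_eq_abs] using tendstoInMeasure_iff_norm.1 h ε hε

end Wpa

/-! ### Averages of independent observations -/

section Averages

variable {Ω 𝒳 : Type*}

/-- The sample average of `f` over the first `n` observations. -/
noncomputable def avg (X : ℕ → Ω → 𝒳) (f : 𝒳 → ℝ) (n : ℕ) (ω : Ω) : ℝ :=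
  (n : ℝ)⁻¹ * ∑ i ∈ Finset.range n, f (X i ω)

theorem abs_avg_le {X : ℕ → Ω → 𝒳} {f o : 𝒳 → ℝ} {ω : Ω}
    (h : ∀ i, |f (X i ω)| ≤ o (X i ω)) (n : ℕ) : |avg X f n ω| ≤ avg X o n ω := by
  rw [avg, avg, abs_mul, abs_of_nonneg (by positivity : (0 : ℝ) ≤ (n : ℝ)⁻¹)]
  gcongr
  exact (Finset.abs_sum_le_sum_abs _ _).trans (Finset.sum_le_sum fun i _ => h i)

variable [MeasurableSpace Ω] [MeasurableSpace 𝒳] {P : Measure Ω} {μ : Measure 𝒳} {X : ℕ → Ω → 𝒳}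

theorem aemeasurable_comp_of_hasLaw (hX : ∀ i, HasLaw (X i) μ P) {β : Type*} [MeasurableSpace β]
    {f : 𝒳 → β} (hf : AEMeasurable f μ) (i : ℕ) : AEMeasurable (fun ω => f (X i ω)) P :=
  ((hX i).map_eq ▸ hf : AEMeasurable f (P.map (X i))).comp_aemeasurable (hX i).aemeasurable

theorem identDistrib_comp_of_hasLaw (hX : ∀ i, HasLaw (X i) μ P) {β : Type*} [MeasurableSpace β]
    {f : 𝒳 → β} (hf : AEMeasurable f μ) (i : ℕ) :
    IdentDistrib (fun ω => f (X i ω)) (fun ω => f (X 0 ω)) P P := by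
  refine ⟨aemeasurable_comp_of_hasLaw hX hf i, aemeasurable_comp_of_hasLaw hX hf 0, ?_⟩
  have h : ∀ j, P.map (fun ω => f (X j ω)) = μ.map f := fun j => by
    have hfj : AEMeasurable f (P.map (X j)) := (hX j).map_eq ▸ hf
    rw [← (hX j).map_eq, AEMeasurable.map_map_of_aemeasurable hfj (hX j).aemeasurable]
    rfl
  rw [h, h]

theorem iIndepFun_comp_of_hasLaw (hind : iIndepFun X P) (hX : ∀ i, HasLaw (X i) μ P) {β : Type*}
    [MeasurableSpace β] {f : 𝒳 → β} (hf : AEMeasurable f μ) :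
    iIndepFun (fun i ω => f (X i ω)) P :=
  hind.comp₀ (fun _ => f) (fun i => (hX i).aemeasurable) fun i => (hX i).map_eq ▸ hf

theorem integral_comp_of_hasLaw (hX : ∀ i, HasLaw (X i) μ P) {f : 𝒳 → ℝ}
    (hf : AEMeasurable f μ) (i : ℕ) : ∫ ω, f (X i ω) ∂P = ∫ x, f x ∂μ := by
  have hfj : AEMeasurable f (P.map (X i)) := (hX i).map_eq ▸ hf
  conv_rhs => rw [← (hX i).map_eq]
  rw [integral_map (hX i).aemeasurable hfj.aestronglyMeasurable]

theorem ae_forall_of_hasLaw (hX : ∀ i, HasLaw (X i) μ P) {p : 𝒳 → Prop} (hp : ∀ᵐ x ∂μ, p x) :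
    ∀ᵐ ω ∂P, ∀ i, p (X i ω) := by
  refine ae_all_iff.2 fun i => ae_of_ae_map (hX i).aemeasurable ?_
  rwa [(hX i).map_eq]

/-- The weak law of large numbers. -/
theorem tendstoInMeasure_avg [IsProbabilityMeasure P] (hind : iIndepFun X P)
    (hX : ∀ i, HasLaw (X i) μ P) {f : 𝒳 → ℝ} (hf : Integrable f μ) :
    TendstoInMeasure P (avg X f) atTop fun _ => ∫ x, f x ∂μ := by
  have hm := hf.aestronglyMeasurable.aemeasurable
  refine tendstoInMeasure_of_tendsto_ae (fun n => ?_) ?_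
  · exact (AEMeasurable.const_mul (Finset.aemeasurable_fun_sum _ fun i _ =>
      aemeasurable_comp_of_hasLaw hX hm i) _).aestronglyMeasurable
  · have hint : Integrable (fun ω => f (X 0 ω)) P :=
      ((hX 0).map_eq ▸ hf : Integrable f (P.map (X 0))).comp_aemeasurable (hX 0).aemeasurable
    have := strong_law_ae_real (fun i ω => f (X i ω)) hint
      (fun i j hij => (iIndepFun_comp_of_hasLaw hind hX hm).indepFun hij)
      (identDistrib_comp_of_hasLaw hX hm)
    rw [integral_comp_of_hasLaw hX hm 0] at this
    filter_upwards [this] with ω hω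
    simpa [avg, div_eq_inv_mul] using hω

/-- A local uniform law of large numbers: if `f x` is continuous on `S`, vanishes at `θ₀ ∈ S` and
has an integrable envelope, then the sample averages of `f` are uniformly small near `θ₀`. -/
theorem wpa_avg_le_near [IsProbabilityMeasure P] (hind : iIndepFun X P)
    (hX : ∀ i, HasLaw (X i) μ P) {E : Type*} [PseudoMetricSpace E]
    [SecondCountableTopology E] {S : Set E} {θ₀ : E} (hθ₀ : θ₀ ∈ S) {f : 𝒳 → E → ℝ}
    (hmeas : ∀ θ ∈ S, AEMeasurable (fun x => f x θ) μ)
    (hcont : ∀ᵐ x ∂μ, ContinuousOn (f x) S) (hzero : ∀ x, f x θ₀ = 0)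
    {K : 𝒳 → ENNReal} (hK : ∫⁻ x, K x ∂μ < ⊤) (hfK : ∀ᵐ x ∂μ, ∀ θ ∈ S, ‖f x θ‖ₑ ≤ K x)
    {ε : ℝ} (hε : 0 < ε) :
    ∃ r > 0, Wpa P fun n ω => ∀ θ ∈ S, dist θ θ₀ < r → |avg X (fun x => f x θ) n ω| ≤ ε := by
  -- Taking the oscillation over a countable dense set keeps it measurable; the envelope `K` itself
  -- need not be.
  obtain ⟨D, hDc, hDd⟩ := TopologicalSpace.exists_countable_dense S
  set B : ℕ → Set S := fun k => {θ | dist (θ : E) θ₀ < 1 / ((k : ℝ) + 1)} with hB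
  have hBo : ∀ k, IsOpen (B k) := fun k =>
    isOpen_lt (continuous_subtype_val.dist continuous_const) continuous_const
  set osc : ℕ → 𝒳 → ENNReal := fun k x => ⨆ θ ∈ B k ∩ D, ‖f x (θ : E)‖ₑ with hosc
  have hoscm : ∀ k, AEMeasurable (osc k) μ := fun k =>
    AEMeasurable.biSup _ (hDc.mono Set.inter_subset_right) fun θ _ => (hmeas θ θ.2).enorm
  have hoscK : ∀ k, ∀ᵐ x ∂μ, osc k x ≤ K x := fun k => by
    filter_upwards [hfK] with x hx
    exact iSup₂_le fun θ _ => hx θ θ.2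
  have hlim : ∀ᵐ x ∂μ, Tendsto (fun k => osc k x) atTop (𝓝 0) := by
    filter_upwards [hcont] with x hx
    rw [ENNReal.tendsto_nhds_zero]
    intro e he
    have h1 : Tendsto (fun θ => ‖f x θ‖ₑ) (𝓝[S] θ₀) (𝓝 0) := by
      have := (hx θ₀ hθ₀).enorm
      simpa [ContinuousWithinAt, hzero] using this
    have h2 : ∀ᶠ θ in 𝓝[S] θ₀, ‖f x θ‖ₑ ≤ e := (ENNReal.tendsto_nhds_zero.1 h1) e he
    obtain ⟨r, hr, hr'⟩ := Metric.mem_nhdsWithin_iff.1 h2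
    obtain ⟨k₀, hk₀⟩ := exists_nat_one_div_lt hr
    filter_upwards [eventually_ge_atTop k₀] with k hk
    refine iSup₂_le fun θ hθ => hr' ⟨?_, θ.2⟩
    refine lt_trans (lt_of_lt_of_le hθ.1 ?_) hk₀
    gcongr
  -- The mean oscillation over shrinking balls vanishes by dominated convergence, with the largest
  -- oscillation `osc 0` as the dominating function.
  have hint : Tendsto (fun k => ∫⁻ x, osc k x ∂μ) atTop (𝓝 0) := by
    have := tendsto_lintegral_of_dominated_convergence' (μ := μ) (F := osc) (f := fun _ => 0)
      (osc 0) hoscm (fun k => ae_of_all _ fun x => ?_) ?_ hlim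
    · simpa using this
    · refine biSup_mono fun θ hθ => ⟨lt_of_lt_of_le (b := 1 / ((k : ℝ) + 1)) hθ.1 ?_, hθ.2⟩
      push_cast
      gcongr
      simp
    · exact ((lintegral_mono_ae (hoscK 0)).trans_lt hK).ne
  obtain ⟨k, hk⟩ := ((tendsto_order.1 hint).2 (ENNReal.ofReal ε) (by simpa using hε)).exists
  have hfin : ∫⁻ x, osc k x ∂μ ≠ ⊤ := (hk.trans_le le_top).ne
  have hoi : Integrable (fun x => (osc k x).toReal) μ := integrable_toReal_of_lintegral_ne_top
    (hoscm k) hfin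
  have hoε : ∫ x, (osc k x).toReal ∂μ < ε := by
    rw [integral_toReal (hoscm k) (ae_lt_top' (hoscm k) hfin)]
    exact (ENNReal.toReal_lt_of_lt_ofReal hk)
  refine ⟨1 / ((k : ℝ) + 1), by positivity, ?_⟩
  -- Continuity carries the bound from the dense set to the whole ball, so the ordinary law of large
  -- numbers for `osc k` controls all `θ` at once.
  have hbound : ∀ᵐ x ∂μ, ∀ θ ∈ S, dist θ θ₀ < 1 / ((k : ℝ) + 1) → |f x θ| ≤ (osc k x).toReal := by
    filter_upwards [hcont, ae_lt_top' (hoscm k) hfin] with x hx hxt θ hθ hd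
    have hcl : IsClosed {t : S | |f x t| ≤ (osc k x).toReal} :=
      isClosed_le (continuousOn_iff_continuous_domRestrict.1 hx).abs continuous_const
    have hsub : B k ∩ D ⊆ {t : S | |f x t| ≤ (osc k x).toReal} := fun t ht => by
      have h1 : ‖f x (t : E)‖ₑ ≤ osc k x := le_iSup₂ (f := fun (θ : S) (_ : θ ∈ B k ∩ D) =>
        ‖f x (θ : E)‖ₑ) t ht
      have := ENNReal.toReal_mono hxt.ne h1
      simpa using this
    have := (hDd.open_subset_closure_inter (hBo k)).trans (closure_minimal hsub hcl)
    exact this (show (⟨θ, hθ⟩ : S) ∈ B k from hd)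
  refine ((Wpa.of_tendstoInMeasure (tendstoInMeasure_avg hind hX hoi)
    (sub_pos.2 hoε)).and (Wpa.of_ae (Q := fun _ ω => ∀ i, ∀ θ ∈ S,
      dist θ θ₀ < 1 / ((k : ℝ) + 1) → |f (X i ω) θ| ≤ (osc k (X i ω)).toReal) ?_)).mono ?_
  · filter_upwards [ae_forall_of_hasLaw hX hbound] with ω hω n using hω
  · rintro n ω ⟨h1, h2⟩ θ hθ hd
    have h3 := abs_avg_le (X := X) (f := fun x => f x θ) (o := fun x => (osc k x).toReal)
      (fun i => h2 i θ hθ hd) n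
    have h4 := (abs_lt.1 h1).2
    linarith

end Averages


/-! ### Regularity of the augmented moments -/

section Regularity

open scoped Matrix.Norms.L2Operator in
-- An entry is a coordinate of the image of a unit basis vector. This passes from spectral-norm
-- envelopes to entrywise ones.
theorem enorm_entry_le_l2_opENorm {ι κ : Type*} [Fintype ι] [Fintype κ] [DecidableEq κ]
    (A : Matrix ι κ ℝ) (i : ι) (k : κ) : ‖A i k‖ₑ ≤ ‖A‖ₑ := by
  rw [enorm_le_iff_norm_le]
  have h := Matrix.l2_opNorm_mulVec A (EuclideanSpace.single k 1)
  rw [PiLp.norm_single, norm_one, mul_one] at h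
  refine le_trans (le_of_eq ?_) ((PiLp.norm_apply_le _ i).trans h)
  simp

/-- Derivatives in the parameter of functions that are measurable in the observation are
measurable in the observation. -/
theorem aemeasurable_fderiv_apply {𝒳 E : Type*} [MeasurableSpace 𝒳] [NormedAddCommGroup E]
    [NormedSpace ℝ E] {μ : Measure 𝒳} {f : 𝒳 → E → ℝ} {U : Set E} (hU : IsOpen U)
    (hf : ∀ θ ∈ U, AEMeasurable (fun x => f x θ) μ) {θ : E} (hθ : θ ∈ U)
    (hd : ∀ᵐ x ∂μ, DifferentiableAt ℝ (f x) θ) (v : E) :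
    AEMeasurable (fun x => fderiv ℝ (f x) θ v) μ := by
  have hnat : Tendsto (fun n : ℕ => (n : ℝ) + 1) atTop atTop :=
    tendsto_atTop_add_const_right _ _ tendsto_natCast_atTop_atTop
  have hlim : Tendsto (fun n : ℕ => θ + ((n : ℝ) + 1)⁻¹ • v) atTop (𝓝 θ) := by
    simpa using ((tendsto_inv_atTop_zero.comp hnat).smul_const v).const_add θ
  obtain ⟨N, hN⟩ := eventually_atTop.1 (hlim.eventually (hU.mem_nhds hθ))
  -- Difference quotients along `v`; the index shift by `N` keeps every evaluation point inside `U`.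
  refine aemeasurable_of_tendsto_metrizable_ae' (f := fun n x =>
    (((n + N : ℕ) : ℝ) + 1) * (f x (θ + (((n + N : ℕ) : ℝ) + 1)⁻¹ • v) - f x θ))
    (fun n => ((hf _ (hN _ (by simp))).sub (hf θ hθ)).const_mul _) ?_
  filter_upwards [hd] with x hx
  exact (hx.hasFDerivAt.lim_real v).comp (hnat.comp (tendsto_add_atTop_nat N))

variable {𝒳 : Type*} {m p : ℕ}

/-- The derivative of the `a`-th augmented moment in the `l`-th parameter. -/
noncomputable def dpsi (g : 𝒳 → Vec p → Vec m) (x : 𝒳) (θ : Vec p) :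
    Matrix (AugIdx m p) (Fin p) ℝ :=
  Matrix.of fun a l => fderiv ℝ (fun t => psi g x t a) θ (EuclideanSpace.single l 1)

theorem contDiffOn_psi {g : 𝒳 → Vec p → Vec m} {x : 𝒳} {U : Set (Vec p)} (hU : IsOpen U)
    (hg : ContDiffOn ℝ 2 (g x) U) (a : AugIdx m p) :
    ContDiffOn ℝ 1 (fun t => psi g x t a) U := by
  have hi : ∀ i, ContDiffOn ℝ 2 (fun t => g x t i) U := contDiffOn_euclidean.1 hg
  rcases a with i | ⟨i, k⟩
  · exact (hi i).of_le (by norm_num)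
  · exact ((hi i).fderiv_of_isOpen hU (by norm_num)).clm_apply contDiffOn_const

theorem fderiv_psi_apply (g : 𝒳 → Vec p → Vec m) (x : 𝒳) (θ : Vec p) (a : AugIdx m p)
    (v : Vec p) : fderiv ℝ (fun t => psi g x t a) θ v = (dpsi g x θ *ᵥ v) a := by
  conv_lhs => rw [← (EuclideanSpace.basisFun (Fin p) ℝ).sum_repr v]
  simp [dpsi, Matrix.mulVec, dotProduct, mul_comm]

variable [MeasurableSpace 𝒳] {Ω : Type*} [MeasurableSpace Ω] {P : Measure Ω} {μ : Measure 𝒳}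
  {X : ℕ → Ω → 𝒳} {g : 𝒳 → Vec p → Vec m} {W : Matrix (Fin m) (Fin m) ℝ} {Θ : Set (Vec p)}
  {θW : Vec p}

theorem Gam_apply (θ : Vec p) (a : AugIdx m p) (l : Fin p) :
    Gam μ g θ a l = ∫ x, dpsi g x θ a l ∂μ := by
  rcases a with i | ik <;> rfl

/-- Only `g` is assumed measurable. Limits of difference quotients give measurability of its
Jacobian, and a second pass gives that of the derivatives of `ψ`. -/
theorem Regular.exists_smooth (h : Regular P μ X g W Θ θW) :
    ∃ U : Set (Vec p), IsOpen U ∧ Θ ⊆ U ∧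
      (∀ θ ∈ U, ∀ a, AEMeasurable (fun x => psi g x θ a) μ) ∧
      (∀ θ ∈ U, ∀ a l, AEMeasurable (fun x => dpsi g x θ a l) μ) ∧
      ∀ᵐ x ∂μ, ∀ a, ContDiffOn ℝ 1 (fun t => psi g x t a) U := by
  obtain ⟨U, hU, hΘU, hm, hs⟩ := h.smooth
  have hs' : ∀ᵐ x ∂μ, ∀ a, ContDiffOn ℝ 1 (fun t => psi g x t a) U :=
    hs.mono fun x hx => contDiffOn_psi hU hx
  have hdiff : ∀ a, ∀ θ ∈ U, ∀ᵐ x ∂μ, DifferentiableAt ℝ (fun t => psi g x t a) θ :=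
    fun a θ hθ => hs'.mono fun x hx =>
      ((hx a).differentiableOn one_ne_zero).differentiableAt (hU.mem_nhds hθ)
  have hg : ∀ i : Fin m, ∀ θ ∈ U, AEMeasurable (fun x => g x θ i) μ := fun i θ hθ =>
    ((EuclideanSpace.proj (𝕜 := ℝ) i).measurable.comp (hm θ hθ)).aemeasurable
  have hψ : ∀ a, ∀ θ ∈ U, AEMeasurable (fun x => psi g x θ a) μ := by
    rintro (i | ⟨i, k⟩) θ hθ
    · exact hg i θ hθ
    · exact aemeasurable_fderiv_apply hU (hg i) hθ (hdiff (Sum.inl i) θ hθ) _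
  exact ⟨U, hU, hΘU, fun θ hθ a => hψ a θ hθ,
    fun θ hθ a l => aemeasurable_fderiv_apply hU (hψ a) hθ (hdiff a θ hθ) _, hs'⟩

/-- The envelope is a supremum over all of `Θ` and may fail to be measurable; later uses need only
monotonicity and scaling of its integral. -/
theorem Regular.exists_envelope_psi (h : Regular P μ X g W Θ θW) (a : AugIdx m p) :
    ∃ K : 𝒳 → ENNReal, ∫⁻ x, K x ∂μ < ⊤ ∧ ∀ x, ∀ θ ∈ Θ, ‖psi g x θ a‖ₑ ≤ K x := by
  rcases a with i | ⟨i, k⟩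
  · refine ⟨_, h.sup_g, fun x θ hθ => le_trans ?_ (le_iSup₂ (f := fun θ _ => ‖g x θ‖ₑ) θ hθ)⟩
    exact enorm_le_iff_norm_le.2 (PiLp.norm_apply_le (g x θ) i)
  · refine ⟨_, h.sup_G, fun x θ hθ => le_trans (enorm_entry_le_l2_opENorm (jac g x θ) i k)
      (le_iSup₂_of_le θ hθ le_rfl)⟩

theorem Regular.exists_envelope_dpsi (h : Regular P μ X g W Θ θW) (a : AugIdx m p) :
    ∃ K : 𝒳 → ENNReal, ∫⁻ x, K x ∂μ < ⊤ ∧ ∀ x, ∀ θ ∈ Θ, ∀ l, ‖dpsi g x θ a l‖ₑ ≤ K x := by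
  rcases a with i | ik
  · exact ⟨_, h.sup_G, fun x θ hθ l => le_trans (enorm_entry_le_l2_opENorm (jac g x θ) i l)
      (le_iSup₂_of_le θ hθ le_rfl)⟩
  · exact ⟨_, h.sup_F, fun x θ hθ l => le_trans (enorm_entry_le_l2_opENorm (curv g x θ) ik l)
      (le_iSup₂_of_le θ hθ le_rfl)⟩

theorem Regular.memLp_psi (h : Regular P μ X g W Θ θW) (a : AugIdx m p) :
    MemLp (fun x => psi g x θW a) 2 μ := by
  obtain ⟨U, -, hΘU, hψ, -, -⟩ := h.exists_smooth
  have hfin : ∫⁻ x, ‖psi g x θW a‖ₑ ^ 2 ∂μ < ⊤ := by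
    rcases a with i | ⟨i, k⟩
    · refine (lintegral_mono fun x => ?_).trans_lt h.sq_g
      gcongr
      exact enorm_le_iff_norm_le.2 (PiLp.norm_apply_le (g x θW) i)
    · refine (lintegral_mono fun x => ?_).trans_lt h.sq_G
      gcongr
      exact enorm_entry_le_l2_opENorm (jac g x θW) i k
  refine ⟨(hψ θW (hΘU h.pseudoTrue.1) a).aestronglyMeasurable, ?_⟩
  rw [eLpNorm_lt_top_iff_lintegral_rpow_enorm_lt_top two_ne_zero ENNReal.ofNat_ne_top]
  simpa using hfin

theorem Regular.integrable_psi (h : Regular P μ X g W Θ θW) {θ : Vec p} (hθ : θ ∈ Θ)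
    (a : AugIdx m p) : Integrable (fun x => psi g x θ a) μ := by
  obtain ⟨U, -, hΘU, hψ, -, -⟩ := h.exists_smooth
  obtain ⟨K, hK, hle⟩ := h.exists_envelope_psi a
  exact ⟨(hψ θ (hΘU hθ) a).aestronglyMeasurable,
    (lintegral_mono fun x => hle x θ hθ).trans_lt hK⟩

theorem Regular.integrable_dpsi (h : Regular P μ X g W Θ θW) {θ : Vec p} (hθ : θ ∈ Θ)
    (a : AugIdx m p) (l : Fin p) : Integrable (fun x => dpsi g x θ a l) μ := by
  obtain ⟨U, -, hΘU, -, hψ, -⟩ := h.exists_smooth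
  obtain ⟨K, hK, hle⟩ := h.exists_envelope_dpsi a
  exact ⟨(hψ θ (hΘU hθ) a l).aestronglyMeasurable,
    (lintegral_mono fun x => hle x θ hθ l).trans_lt hK⟩

theorem Regular.psiTildePop_apply [IsProbabilityMeasure μ] (h : Regular P μ X g W Θ θW)
    {θ : Vec p} (hθ : θ ∈ Θ) (a : AugIdx m p) :
    psiTildePop μ g θW θ a = ∫ x, psi g x θ a ∂μ - psiPop μ g θW a := by
  simp [psiTildePop, psiTilde, integral_sub (h.integrable_psi hθ a) (integrable_const _)]

/-- Bilinearity of covariance identifies `Σ` as a covariance matrix; both its semidefiniteness and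
the variance in the central limit theorem come from this. -/
theorem Regular.variance_dotProduct_psi [IsProbabilityMeasure μ] (h : Regular P μ X g W Θ θW)
    (v : AugIdx m p → ℝ) :
    Var[fun x => v ⬝ᵥ psi g x θW; μ] = v ⬝ᵥ Sig μ g θW *ᵥ v := by
  have hm : ∀ a, MemLp (fun x => v a * psi g x θW a) 2 μ := fun a => (h.memLp_psi a).const_mul _
  have hv : MemLp (fun x => v ⬝ᵥ psi g x θW) 2 μ := by
    simpa [dotProduct] using memLp_finsetSum Finset.univ fun a _ => hm a
  rw [← covariance_self hv.aestronglyMeasurable.aemeasurable]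
  simp only [dotProduct, Matrix.mulVec, Finset.mul_sum]
  rw [covariance_fun_sum_fun_sum hm hm]
  refine Finset.sum_congr rfl fun a _ => Finset.sum_congr rfl fun b _ => ?_
  rw [covariance_const_mul_left, covariance_const_mul_right,
    covariance_eq_sub (h.memLp_psi a) (h.memLp_psi b)]
  simp only [Sig, psiPop, Matrix.of_apply, Pi.mul_apply]
  ring

theorem Regular.posSemidef_Sig [IsProbabilityMeasure μ] (h : Regular P μ X g W Θ θW) :
    (Sig μ g θW).PosSemidef := by
  refine Matrix.PosSemidef.of_dotProduct_mulVec_nonneg ?_ fun v => ?_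
  · ext a b
    simp [Sig, mul_comm]
  · rw [star_trivial, ← h.variance_dotProduct_psi]
    exact variance_nonneg _ _

theorem Regular.posDef_Sig [IsProbabilityMeasure μ] (h : Regular P μ X g W Θ θW)
    (hS : IsUnit (Sig μ g θW).det) : (Sig μ g θW).PosDef :=
  h.posSemidef_Sig.posDef_iff_isUnit.2 ((Matrix.isUnit_iff_isUnit_det _).2 hS)

end Regularity


/-! ### Consistency and stochastic differentiability -/

section Consistency

/-- Working with all small `s > 0` rather than a minimum also covers an empty index type. -/
theorem exists_pos_forall_le {ι : Type*} [Finite ι] {r : ι → ℝ} (hr : ∀ i, 0 < r i) :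
    ∃ r₀ > 0, ∀ i, r₀ ≤ r i := by
  have h : ∀ᶠ s in 𝓝[>] (0 : ℝ), ∀ i, s ≤ r i := eventually_all.2 fun i =>
    mem_of_superset (Ioo_mem_nhdsGT (hr i)) fun s hs => hs.2.le
  obtain ⟨s, hs, hs0⟩ := (h.and self_mem_nhdsWithin).exists
  exact ⟨s, hs0, hs⟩

theorem avg_sub {Ω 𝒳 : Type*} (X : ℕ → Ω → 𝒳) (f f' : 𝒳 → ℝ) (n : ℕ) (ω : Ω) :
    avg X (fun x => f x - f' x) n ω = avg X f n ω - avg X f' n ω := by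
  simp [avg, Finset.sum_sub_distrib, mul_sub]

theorem avg_const_mul {Ω 𝒳 : Type*} (X : ℕ → Ω → 𝒳) (c : ℝ) (f : 𝒳 → ℝ) (n : ℕ) (ω : Ω) :
    avg X (fun x => c * f x) n ω = c * avg X f n ω := by
  simp only [avg, ← Finset.mul_sum]
  ring

theorem avg_sum {Ω 𝒳 ι : Type*} (X : ℕ → Ω → 𝒳) (s : Finset ι) (f : ι → 𝒳 → ℝ) (n : ℕ) (ω : Ω) :
    avg X (fun x => ∑ l ∈ s, f l x) n ω = ∑ l ∈ s, avg X (f l) n ω := by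
  simp only [avg]
  rw [Finset.sum_comm, Finset.mul_sum]

variable {Ω 𝒳 : Type*} [MeasurableSpace 𝒳] {m p : ℕ} {μ : Measure 𝒳} {X : ℕ → Ω → 𝒳}
  {g : 𝒳 → Vec p → Vec m} {W : Matrix (Fin m) (Fin m) ℝ} {Θ : Set (Vec p)} {θW : Vec p}

theorem psiTildeBar_apply (n : ℕ) (ω : Ω) (θ : Vec p) (a : AugIdx m p) :
    psiTildeBar μ g θW X n ω θ a = avg X (fun x => psiTilde μ g θW x θ a) n ω := by
  simp [psiTildeBar, avg, Finset.sum_apply]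

theorem psiTildeBar_sub_apply (n : ℕ) (ω : Ω) (θ θ' : Vec p) (a : AugIdx m p) :
    psiTildeBar μ g θW X n ω θ a - psiTildeBar μ g θW X n ω θ' a =
      avg X (fun x => psi g x θ a - psi g x θ' a) n ω := by
  rw [psiTildeBar_apply, psiTildeBar_apply, ← avg_sub]
  simp [psiTilde]

variable [MeasurableSpace Ω] {P : Measure Ω}

theorem IsMEstimator.wpa_near {L : Matrix (Fin p) (AugIdx m p) ℝ}
    {Lhat : ℕ → Ω → Matrix (Fin p) (AugIdx m p) ℝ} {θhat : ℕ → Ω → Vec p}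
    (hM : IsMEstimator P μ X g Θ θW L Lhat θhat) {ε : ℝ} (hε : 0 < ε) :
    Wpa P fun n ω => ∀ k a, |Lhat n ω k a - L k a| < ε :=
  Wpa.forall fun k => Wpa.forall fun a => Wpa.of_tendstoInMeasure (hM.consistent k a) hε

variable [IsProbabilityMeasure P]

/-- The law of large numbers at `θ₀` and the local uniform law for the increments from `θ₀`
contribute `ε / 2` each. -/
theorem Regular.wpa_psiTildeBar_near [IsProbabilityMeasure μ] (h : Regular P μ X g W Θ θW)
    {θ₀ : Vec p} (hθ₀ : θ₀ ∈ Θ) {ε : ℝ} (hε : 0 < ε) :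
    ∃ r > 0, Wpa P fun n ω => ∀ θ ∈ Θ, dist θ θ₀ < r →
      ∀ a, |psiTildeBar μ g θW X n ω θ a - psiTildePop μ g θW θ₀ a| < ε := by
  obtain ⟨U, hU, hΘU, hψ, -, hs⟩ := h.exists_smooth
  have hloc : ∀ a : AugIdx m p, ∃ r > 0, Wpa P fun n ω => ∀ θ ∈ Θ, dist θ θ₀ < r →
      |avg X (fun x => psi g x θ a - psi g x θ₀ a) n ω| ≤ ε / 2 := fun a => by
    obtain ⟨K, hK, hle⟩ := h.exists_envelope_psi a
    refine wpa_avg_le_near h.indep h.law (f := fun x θ => psi g x θ a - psi g x θ₀ a) hθ₀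
      (fun θ hθ => (hψ θ (hΘU hθ) a).sub (hψ θ₀ (hΘU hθ₀) a)) ?_ (fun x => sub_self _)
      (K := fun x => 2 * K x) ?_ ?_ (half_pos hε)
    · filter_upwards [hs] with x hx
      exact ((hx a).continuousOn.mono hΘU).sub continuousOn_const
    · rw [lintegral_const_mul' _ _ ENNReal.ofNat_ne_top]
      exact ENNReal.mul_lt_top ENNReal.ofNat_lt_top hK
    · refine ae_of_all _ fun x θ hθ => enorm_sub_le.trans ?_
      rw [two_mul]
      exact add_le_add (hle x θ hθ) (hle x θ₀ hθ₀)
  choose r hr hw using hloc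
  obtain ⟨r₀, hr₀, hle⟩ := exists_pos_forall_le hr
  have hpt : ∀ a : AugIdx m p, Wpa P fun n ω =>
      |psiTildeBar μ g θW X n ω θ₀ a - psiTildePop μ g θW θ₀ a| < ε / 2 := fun a => by
    have hint : Integrable (fun x => psiTilde μ g θW x θ₀ a) μ :=
      (h.integrable_psi hθ₀ a).sub (integrable_const _)
    refine (Wpa.of_tendstoInMeasure (tendstoInMeasure_avg h.indep h.law hint) (half_pos hε)).mono ?_
    intro n ω hω
    rwa [psiTildeBar_apply]
  refine ⟨r₀, hr₀, ((Wpa.forall hw).and (Wpa.forall hpt)).mono ?_⟩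
  rintro n ω ⟨h1, h2⟩ θ hθ hd a
  have h3 := h1 a θ hθ (hd.trans_le (hle a))
  rw [← psiTildeBar_sub_apply (μ := μ) (θW := θW)] at h3
  have h4 := abs_sub_le (psiTildeBar μ g θW X n ω θ a) (psiTildeBar μ g θW X n ω θ₀ a)
    (psiTildePop μ g θW θ₀ a)
  have h5 := h2 a
  linarith

/-- The product is jointly continuous in matrix and vector, so nonvanishing is an open condition,
and sup-metric balls are described entrywise. -/
theorem exists_pos_mulVec_ne_zero {ι κ : Type*} [Fintype ι] [Fintype κ] {L : Matrix κ ι ℝ}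
    {v : ι → ℝ} (h : L *ᵥ v ≠ 0) :
    ∃ ε > 0, ∀ L' : Matrix κ ι ℝ, (∀ k a, |L' k a - L k a| < ε) →
      ∀ v' : ι → ℝ, (∀ a, |v' a - v a| < ε) → L' *ᵥ v' ≠ 0 := by
  have hc : Continuous fun q : (κ → ι → ℝ) × (ι → ℝ) => Matrix.of q.1 *ᵥ q.2 := by
    refine continuous_pi fun k => ?_
    simp only [Matrix.mulVec, dotProduct, Matrix.of_apply]
    fun_prop
  obtain ⟨ε, hε, hb⟩ := Metric.isOpen_iff.1 (isOpen_ne_fun hc continuous_const) (⟨L, v⟩) h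
  refine ⟨ε, hε, fun L' hL' v' hv' =>
    @hb ((L' : κ → ι → ℝ), v') ?_⟩
  rw [Metric.mem_ball, Prod.dist_eq, max_lt_iff]
  exact ⟨(dist_pi_lt_iff hε).2 fun k => (dist_pi_lt_iff hε).2 fun a => hL' k a,
    (dist_pi_lt_iff hε).2 fun a => hv' a⟩

/-- Each point of `Θ` at distance at least `δ` from `θW` has a neighbourhood on which, with
probability tending to one, the sample equation has no solution. Finitely many such neighbourhoods
cover that part of `Θ`. -/
theorem IsMEstimator.wpa_dist_lt [IsProbabilityMeasure μ] (h : Regular P μ X g W Θ θW)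
    {L : Matrix (Fin p) (AugIdx m p) ℝ} (hL : Admissible μ g Θ θW L)
    {Lhat : ℕ → Ω → Matrix (Fin p) (AugIdx m p) ℝ} {θhat : ℕ → Ω → Vec p}
    (hM : IsMEstimator P μ X g Θ θW L Lhat θhat) {δ : ℝ} (hδ : 0 < δ) :
    Wpa P fun n ω => dist (θhat n ω) θW < δ := by
  have hloc : ∀ θ₀ ∈ Θ \ Metric.ball θW δ, ∃ r > 0, Wpa P fun n ω => ∀ θ ∈ Θ, dist θ θ₀ < r →
      Lhat n ω *ᵥ psiTildeBar μ g θW X n ω θ ≠ 0 := by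
    rintro θ₀ ⟨hθ₀, hfar⟩
    have hne : θ₀ ≠ θW := fun he => hfar (he ▸ Metric.mem_ball_self hδ)
    obtain ⟨ε, hε, hb⟩ := exists_pos_mulVec_ne_zero (hL.ident θ₀ hθ₀ hne)
    obtain ⟨r, hr, hw⟩ := h.wpa_psiTildeBar_near hθ₀ hε
    exact ⟨r, hr, ((hM.wpa_near hε).and hw).mono fun n ω hω θ hθ hd =>
      hb _ hω.1 _ (hω.2 θ hθ hd)⟩
  choose! r hr hw using hloc
  have hcomp : IsCompact (Θ \ Metric.ball θW δ) := h.compact.diff Metric.isOpen_ball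
  obtain ⟨t, ht, hcov⟩ := hcomp.elim_nhds_subcover (fun θ₀ => Metric.ball θ₀ (r θ₀))
    fun θ₀ hθ₀ => Metric.ball_mem_nhds _ (hr θ₀ hθ₀)
  have hsol : Wpa P fun n ω => θhat n ω ∈ Θ ∧
      Lhat n ω *ᵥ psiTildeBar μ g θW X n ω (θhat n ω) = 0 := hM.solves
  refine (hsol.and (Wpa.forall_finset t fun θ₀ hθ₀ => hw θ₀ (ht θ₀ hθ₀))).mono ?_
  rintro n ω ⟨⟨hmem, heq⟩, hnz⟩
  by_contra hfar
  have hmem' : θhat n ω ∈ Θ \ Metric.ball θW δ := ⟨hmem, hfar⟩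
  obtain ⟨θ₀, hθ₀, hb⟩ := Set.mem_iUnion₂.1 (hcov hmem')
  exact hnz θ₀ hθ₀ _ hmem hb heq

theorem abs_mulVec_apply_le {ι : Type*} {A : Matrix ι (Fin p) ℝ} {a : ι} {c : ℝ}
    (h : ∀ l, |A a l| ≤ c) (d : Vec p) : |(A *ᵥ d) a| ≤ p * c * ‖d‖ := by
  calc |(A *ᵥ d) a| ≤ ∑ l, |A a l * d l| := by
        simp only [Matrix.mulVec, dotProduct]
        exact Finset.abs_sum_le_sum_abs _ _
    _ ≤ ∑ _l : Fin p, c * ‖d‖ := Finset.sum_le_sum fun l _ => by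
        rw [abs_mul]
        exact mul_le_mul (h l) (PiLp.norm_apply_le d l) (abs_nonneg _) ((abs_nonneg _).trans (h l))
    _ = p * c * ‖d‖ := by simp [mul_assoc]

/-- Near `θW` the recentred sample moments are, uniformly, linear in the parameter up to a small
multiple of the distance to `θW`. -/
theorem Regular.wpa_psiTildeBar_linearize (h : Regular P μ X g W Θ θW) {η : ℝ} (hη : 0 < η) :
    ∃ r > 0, Wpa P fun n ω => ∀ θ, dist θ θW < r → ∀ a,
      |psiTildeBar μ g θW X n ω θ a - psiTildeBar μ g θW X n ω θW a
        - (Gam μ g θW *ᵥ (θ - θW).ofLp) a| ≤ η * ‖θ - θW‖ := by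
  obtain ⟨U, hU, hΘU, hψ, hdψ, hs⟩ := h.exists_smooth
  have hWΘ := h.pseudoTrue.1
  obtain ⟨r₁, hr₁, hball⟩ := Metric.mem_nhds_iff.1 (mem_interior_iff_mem_nhds.1 h.interior)
  set S := Metric.ball θW r₁ with hS
  have hWS : θW ∈ S := Metric.mem_ball_self hr₁
  -- The normalized Taylor remainder. Because `0⁻¹ = 0` it vanishes at `θW`, and its continuity
  -- there is exactly differentiability of `ψ`.
  set q : AugIdx m p → 𝒳 → Vec p → ℝ := fun a x θ =>
    ‖θ - θW‖⁻¹ * (psi g x θ a - psi g x θW a - (dpsi g x θW *ᵥ (θ - θW).ofLp) a) with hq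
  have hloc : ∀ a : AugIdx m p, ∃ r > 0, Wpa P fun n ω => ∀ θ ∈ S, dist θ θW < r →
      |avg X (fun x => q a x θ) n ω| ≤ η / 2 := fun a => by
    obtain ⟨K, hK, hle⟩ := h.exists_envelope_dpsi a
    refine wpa_avg_le_near h.indep h.law (f := q a) hWS (fun θ hθ => ?_) ?_ (fun x => by simp [hq])
      (K := fun x => ENNReal.ofReal (2 * p) * K x) ?_ ?_ (half_pos hη)
    · refine (((hψ θ (hΘU (hball hθ)) a).sub (hψ θW (hΘU hWΘ) a)).sub ?_).const_mul _
      simp only [Matrix.mulVec, dotProduct]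
      exact Finset.aemeasurable_fun_sum _ fun l _ => (hdψ θW (hΘU hWΘ) a l).mul_const _
    · filter_upwards [hs] with x hx θ hθ
      have hdiff : ∀ t ∈ S, DifferentiableAt ℝ (fun t => psi g x t a) t := fun t ht =>
        ((hx a).differentiableOn one_ne_zero).differentiableAt (hU.mem_nhds (hΘU (hball ht)))
      refine ContinuousAt.continuousWithinAt ?_
      by_cases hθW : θ = θW
      · subst hθW
        have hd := (hdiff θ hWS).hasFDerivAt
        rw [hasFDerivAt_iff_tendsto] at hd
        have : q a x θ = 0 := by simp [hq]
        rw [ContinuousAt, this]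
        refine (tendsto_zero_iff_norm_tendsto_zero.2 (hd.congr fun t => ?_))
        simp only [hq, norm_mul, norm_inv, norm_norm, fderiv_psi_apply]
      · have hne : ‖θ - θW‖ ≠ 0 := norm_ne_zero_iff.2 (sub_ne_zero.2 hθW)
        have h1 : ContinuousAt (fun t : Vec p => (dpsi g x θW *ᵥ (t - θW).ofLp) a) θ := by
          simp only [← fderiv_psi_apply]
          fun_prop
        have h2 : ContinuousAt (fun t : Vec p => ‖t - θW‖⁻¹) θ :=
          ContinuousAt.inv₀ (by fun_prop) hne
        exact h2.mul (((hdiff θ hθ).continuousAt.sub continuousAt_const).sub h1)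
    · rw [lintegral_const_mul' _ _ ENNReal.ofReal_ne_top]
      exact ENNReal.mul_lt_top ENNReal.ofReal_lt_top hK
    · filter_upwards [hs] with x hx θ hθ
      -- Without measurability, a finite integral does not make `K` finite almost everywhere, so `K
      -- x = ⊤` is treated separately; for `p = 0` the factor `2 * p` kills it, but then `θ = θW`.
      rcases eq_or_ne (K x) ⊤ with hKx | hKx
      · rcases Nat.eq_zero_or_pos p with rfl | hp
        · have : θ = θW := Subsingleton.elim _ _
          simp [hq, this]
        · rw [hKx, ENNReal.mul_top (by simpa using hp.ne')]
          exact le_top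
      have hle' : ∀ t ∈ Θ, ∀ l, |dpsi g x t a l| ≤ (K x).toReal := fun t ht l => by
        simpa using ENNReal.toReal_mono hKx (hle x t ht l)
      have hdiff : ∀ t ∈ S, DifferentiableAt ℝ (fun t => psi g x t a) t := fun t ht =>
        ((hx a).differentiableOn one_ne_zero).differentiableAt (hU.mem_nhds (hΘU (hball ht)))
      -- Mean value inequality on the ball `S`, which is convex and contained in `Θ`.
      have hmv : |psi g x θ a - psi g x θW a| ≤ p * (K x).toReal * ‖θ - θW‖ := by
        refine (convex_ball θW r₁).norm_image_sub_le_of_norm_fderiv_le hdiff (fun t ht => ?_) hWS hθ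
        refine ContinuousLinearMap.opNorm_le_bound _ (by positivity) fun v => ?_
        rw [fderiv_psi_apply]
        exact abs_mulVec_apply_le (hle' t (hball ht)) v
      have hlin := abs_mulVec_apply_le (hle' θW hWΘ) (θ - θW)
      have hreal : ‖q a x θ‖ ≤ 2 * p * (K x).toReal := by
        simp only [hq, norm_mul, norm_inv, norm_norm]
        rcases eq_or_ne θ θW with rfl | hne
        · simp; positivity
        · have hpos : 0 < ‖θ - θW‖ := norm_pos_iff.2 (sub_ne_zero.2 hne)
          rw [inv_mul_le_iff₀ hpos]
          refine (norm_sub_le _ _).trans ?_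
          rw [Real.norm_eq_abs, Real.norm_eq_abs]
          linarith
      rw [← ofReal_norm, ← ENNReal.ofReal_toReal hKx, ← ENNReal.ofReal_mul (by positivity)]
      exact ENNReal.ofReal_le_ofReal hreal
  choose r hr hw using hloc
  obtain ⟨r₀, hr₀, hle⟩ := exists_pos_forall_le hr
  -- Entrywise accuracy `c` for the averaged Jacobian costs at most `p * c ≤ η / 2` on the linear
  -- term; the remainder takes the other half. The `+ 1` allows `p = 0`.
  set c := η / (2 * (p + 1)) with hc
  have hc0 : 0 < c := by positivity
  have hpc : p * c ≤ η / 2 := by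
    rw [hc, mul_div_assoc', div_le_div_iff₀ (by positivity) two_pos]
    nlinarith
  have hpt : ∀ (a : AugIdx m p) (l : Fin p), Wpa P fun n ω =>
      |avg X (fun x => dpsi g x θW a l) n ω - Gam μ g θW a l| < c := fun a l => by
    rw [Gam_apply]
    exact Wpa.of_tendstoInMeasure
      (tendstoInMeasure_avg h.indep h.law (h.integrable_dpsi hWΘ a l)) hc0
  refine ⟨min r₀ r₁, lt_min hr₀ hr₁,
    ((Wpa.forall hw).and (Wpa.forall fun a => Wpa.forall (hpt a))).mono ?_⟩
  rintro n ω ⟨h1, h2⟩ θ hd a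
  rcases eq_or_ne θ θW with rfl | hne
  · simp
  have hpos : 0 < ‖θ - θW‖ := norm_pos_iff.2 (sub_ne_zero.2 hne)
  have h3 := h1 a θ (hd.trans_le (min_le_right _ _))
    ((hd.trans_le (min_le_left _ _)).trans_le (hle a))
  have h4 : avg X (fun x => (dpsi g x θW *ᵥ (θ - θW).ofLp) a) n ω =
      (Matrix.of (fun a l => avg X (fun x => dpsi g x θW a l) n ω) *ᵥ (θ - θW).ofLp) a := by
    simp only [Matrix.mulVec, dotProduct, Matrix.of_apply]
    rw [avg_sum]
    refine Finset.sum_congr rfl fun l _ => ?_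
    rw [mul_comm, ← avg_const_mul]
    simp only [mul_comm]
  have h5 := abs_mulVec_apply_le
    (A := Matrix.of (fun a l => avg X (fun x => dpsi g x θW a l) n ω) - Gam μ g θW) (a := a)
    (fun l => (h2 a l).le) (θ - θW)
  rw [Matrix.sub_mulVec, Pi.sub_apply, ← h4] at h5
  simp only [hq] at h3
  rw [avg_const_mul, avg_sub, ← psiTildeBar_sub_apply (μ := μ) (θW := θW), abs_mul, abs_inv,
    abs_norm, inv_mul_le_iff₀ hpos] at h3
  have h6 := abs_sub_le (psiTildeBar μ g θW X n ω θ a - psiTildeBar μ g θW X n ω θW a)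
    (avg X (fun x => (dpsi g x θW *ᵥ (θ - θW).ofLp) a) n ω) ((Gam μ g θW *ᵥ (θ - θW).ofLp) a)
  have h7 : p * c * ‖θ - θW‖ ≤ η / 2 * ‖θ - θW‖ := by gcongr
  linarith

end Consistency


/-! ### Asymptotic normality -/

section Normality

open scoped RealInnerProductSpace

theorem charFun_map_eq_charFun_inner {Ω E : Type*} [MeasurableSpace Ω] [NormedAddCommGroup E]
    [InnerProductSpace ℝ E] [MeasurableSpace E] [BorelSpace E] [SecondCountableTopology E]
    {P : Measure Ω} {Z : Ω → E} (hZ : AEMeasurable Z P) (t : E) :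
    charFun (P.map Z) t = charFun (P.map fun ω => ⟪Z ω, t⟫) 1 := by
  rw [charFun_apply, charFun_apply_real, integral_map hZ (by fun_prop),
    integral_map (by fun_prop) (by fun_prop)]
  simp

/-- The multivariate central limit theorem. -/
theorem tendstoInDistribution_inv_sqrt_smul_sum {Ω 𝒳 : Type*} [MeasurableSpace Ω]
    [MeasurableSpace 𝒳] {P : Measure Ω} [IsProbabilityMeasure P] {μ : Measure 𝒳} {X : ℕ → Ω → 𝒳}
    (hind : iIndepFun X P) (hX : ∀ i, HasLaw (X i) μ P) {p : ℕ} {f : 𝒳 → Vec p}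
    (hf : AEMeasurable f μ) (hL2 : ∀ t, MemLp (fun x => ⟪f x, t⟫) 2 μ)
    (hmean : ∀ t, ∫ x, ⟪f x, t⟫ ∂μ = 0) {S : Matrix (Fin p) (Fin p) ℝ} (hS : S.PosSemidef)
    (hvar : ∀ t : Vec p, Var[fun x => ⟪f x, t⟫; μ] = t.ofLp ⬝ᵥ S *ᵥ t.ofLp) :
    TendstoInDistribution (fun (n : ℕ) ω => (√n)⁻¹ • ∑ i ∈ Finset.range n, f (X i ω)) atTop
      (id : Vec p → Vec p) (fun _ => P) (multivariateGaussian 0 S) := by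
  have hmeas : ∀ n : ℕ, AEMeasurable (fun ω => (√n)⁻¹ • ∑ i ∈ Finset.range n, f (X i ω)) P :=
    fun n => (continuous_const_smul (√(n : ℝ))⁻¹).measurable.comp_aemeasurable
      (Finset.aemeasurable_fun_sum _ fun i _ => aemeasurable_comp_of_hasLaw hX hf i)
  refine ⟨hmeas, aemeasurable_id, ProbabilityMeasure.tendsto_iff_tendsto_charFun.2 fun t => ?_⟩
  have hft : AEMeasurable (fun x => ⟪f x, t⟫) μ := by fun_prop
  have hvar0 : Var[fun ω => ⟪f (X 0 ω), t⟫; P] = t.ofLp ⬝ᵥ S *ᵥ t.ofLp := by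
    rw [← hvar t]
    have hft0 : AEMeasurable (fun x => ⟪f x, t⟫) (P.map (X 0)) := (hX 0).map_eq ▸ hft
    conv_rhs => rw [← (hX 0).map_eq]
    rw [variance_map hft0 (hX 0).aemeasurable]
    rfl
  -- Cramér–Wold: the scalar central limit theorem for `⟪f, t⟫`, read at frequency `1`, is
  -- convergence of the vector characteristic function at `t`.
  have h1 := tendstoInDistribution_inv_sqrt_mul_sum_sub (P := P)
    (P' := gaussianReal 0 Var[fun ω => ⟪f (X 0 ω), t⟫; P].toNNReal) (Y := id)
    (X := fun i ω => ⟪f (X i ω), t⟫) HasLaw.id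
    (((hX 0).map_eq ▸ hL2 t : MemLp (fun x => ⟪f x, t⟫) 2 (P.map (X 0))).comp_of_map
      (hX 0).aemeasurable)
    (iIndepFun_comp_of_hasLaw hind hX hft) (identDistrib_comp_of_hasLaw hX hft)
  simp only [integral_comp_of_hasLaw hX hft 0, hmean t] at h1
  have h2 := ProbabilityMeasure.tendsto_iff_tendsto_charFun.1 h1.tendsto 1
  simp only [ProbabilityMeasure.coe_mk, Measure.map_id, mul_zero, sub_zero] at h2 ⊢
  have hlim : charFun (gaussianReal 0 Var[fun ω => ⟪f (X 0 ω), t⟫; P].toNNReal) 1 =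
      charFun (multivariateGaussian 0 S) t := by
    rw [charFun_multivariateGaussian hS, charFun_gaussianReal,
      Real.coe_toNNReal _ (variance_nonneg _ _), hvar0]
    simp
  rw [← hlim]
  refine h2.congr fun n => ?_
  rw [charFun_map_eq_charFun_inner (hmeas n) t]
  simp [inner_smul_left, sum_inner]

/-- A sequence bounded by arbitrarily small multiples of a tight sequence tends to zero in
probability. -/
theorem tendstoInMeasure_zero_of_wpa_norm_le {Ω E : Type*} [MeasurableSpace Ω]
    [NormedAddCommGroup E] {P : Measure Ω} {R : ℕ → Ω → E} {ζ : ℕ → Ω → ℝ}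
    (hR : ∀ δ > 0, Wpa P fun n ω => ‖R n ω‖ ≤ δ * ζ n ω)
    (hζ : ∀ e : ENNReal, 0 < e → ∃ M > 0, ∀ n, P {ω | M ≤ ζ n ω} ≤ e) :
    TendstoInMeasure P R atTop 0 := by
  rw [tendstoInMeasure_iff_norm]
  intro ε hε
  rw [ENNReal.tendsto_nhds_zero]
  intro e he
  obtain ⟨M, hM, hMe⟩ := hζ (e / 2) (ENNReal.half_pos he.ne')
  filter_upwards [(ENNReal.tendsto_nhds_zero.1 (hR (ε / M) (by positivity))) (e / 2)
    (ENNReal.half_pos he.ne')] with n hn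
  refine le_trans ((measure_mono fun ω hω => ?_).trans (measure_union_le _ _))
    ((add_le_add hn (hMe n)).trans_eq (ENNReal.add_halves e))
  by_contra hcon
  simp only [Set.mem_union, Set.mem_ofPred_eq, not_or, not_le, Pi.zero_apply,
    sub_zero] at hω hcon
  have : ε / M * ζ n ω < ε / M * M := by
    gcongr
    exact hcon.2
  rw [div_mul_cancel₀ _ hM.ne'] at this
  linarith [hcon.1]

/-- Normalized sample averages of a centred square-integrable function are tight. -/
theorem exists_forall_measure_le_sqrt_mul_avg {Ω 𝒳 : Type*} [MeasurableSpace Ω]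
    [MeasurableSpace 𝒳] {P : Measure Ω} [IsProbabilityMeasure P] {μ : Measure 𝒳} {X : ℕ → Ω → 𝒳}
    (hind : iIndepFun X P) (hX : ∀ i, HasLaw (X i) μ P) {f : 𝒳 → ℝ} (hf : MemLp f 2 μ)
    (hmean : ∫ x, f x ∂μ = 0) {e : ENNReal} (he : 0 < e) :
    ∃ M > 0, ∀ n : ℕ, P {ω | M ≤ √n * |avg X f n ω|} ≤ e := by
  have hfm := hf.aestronglyMeasurable.aemeasurable
  have hfX : ∀ i, MemLp (fun ω => f (X i ω)) 2 P := fun i =>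
    ((hX i).map_eq ▸ hf : MemLp f 2 (P.map (X i))).comp_of_map (hX i).aemeasurable
  set V := Var[fun ω => f (X 0 ω); P] with hV
  have hVi : ∀ i, Var[fun ω => f (X i ω); P] = V := fun i =>
    (identDistrib_comp_of_hasLaw hX hfm i).variance_eq
  have hV0 : 0 ≤ V := variance_nonneg _ _
  -- Chebyshev's bound `V / M ^ 2` does not depend on `n`, so one large `M` serves every sample
  -- size.
  have hlim : Tendsto (fun M : ℝ => ENNReal.ofReal (V / M ^ 2)) atTop (𝓝 0) := by
    rw [← ENNReal.ofReal_zero]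
    exact ENNReal.tendsto_ofReal (tendsto_const_nhds.div_atTop (tendsto_pow_atTop two_ne_zero))
  obtain ⟨M, hMe, hM⟩ := ((ENNReal.tendsto_nhds_zero.1 hlim e he).and
    (eventually_gt_atTop (0 : ℝ))).exists
  refine ⟨M, hM, fun n => le_trans ?_ hMe⟩
  set Z : Ω → ℝ := fun ω => (√n)⁻¹ * ∑ i ∈ Finset.range n, f (X i ω) with hZ
  have hZ2 : MemLp Z 2 P := (memLp_finsetSum _ fun i _ => hfX i).const_mul _
  have hZ0 : ∫ ω, Z ω ∂P = 0 := by
    rw [hZ, integral_const_mul, integral_finsetSum _ fun i _ => (hfX i).integrable one_le_two]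
    simp [integral_comp_of_hasLaw hX hfm, hmean]
  have hZV : Var[Z; P] ≤ V := by
    have hs : Var[fun ω => ∑ i ∈ Finset.range n, f (X i ω); P] = n * V := by
      have := IndepFun.variance_sum (μ := P) (X := fun i ω => f (X i ω)) (s := Finset.range n)
        (fun i _ => hfX i) fun i _ j _ hij => (iIndepFun_comp_of_hasLaw hind hX hfm).indepFun hij
      simp only [hVi, Finset.sum_const, Finset.card_range, nsmul_eq_mul] at this
      rw [← this]
      congr 1
      ext ω
      simp
    rw [hZ, variance_const_mul, hs, inv_pow, Real.sq_sqrt (Nat.cast_nonneg n)]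
    rcases Nat.eq_zero_or_pos n with rfl | hn
    · simpa using hV0
    · rw [inv_mul_cancel_left₀ (by positivity)]
  have hset : ∀ ω, √n * |avg X f n ω| = |Z ω - ∫ ω, Z ω ∂P| := fun ω => by
    rw [hZ0, sub_zero, hZ, avg, abs_mul, abs_mul, ← mul_assoc]
    congr 1
    rw [abs_of_nonneg (by positivity), abs_of_nonneg (by positivity)]
    rcases Nat.eq_zero_or_pos n with rfl | hn
    · simp
    · have : (0 : ℝ) < n := by positivity
      field_simp
      rw [Real.sq_sqrt this.le]
  simp only [hset]
  exact (meas_ge_le_variance_div_sq hZ2 hM).trans (ENNReal.ofReal_le_ofReal (by gcongr))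

/-- Perturbation bound for an approximately linear equation `A' h = 0` with `A'` close to `A` and
`h` close to `h₀ + Γ d`. -/
theorem exists_norm_add_le_of_approx_linear {E F H : Type*} [NormedAddCommGroup E]
    [NormedSpace ℝ E] [NormedAddCommGroup F] [NormedSpace ℝ F] [NormedAddCommGroup H]
    [NormedSpace ℝ H] (A : F →L[ℝ] H) (Γ : E →L[ℝ] F) (B : H →L[ℝ] E)
    (hB : ∀ d, B (A (Γ d)) = d) {ε : ℝ} (hε : 0 < ε) :
    ∃ η > 0, ∀ A' : F → H, (∀ v, ‖A v - A' v‖ ≤ η * ‖v‖) → ∀ d h₀ h,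
      ‖h - h₀ - Γ d‖ ≤ η * ‖d‖ → A' h = 0 → ‖d + B (A h₀)‖ ≤ ε * ‖h₀‖ := by
  set b := ‖B‖
  set a := ‖A‖
  set γ := ‖Γ‖
  have hb : 0 ≤ b := norm_nonneg _
  have ha : 0 ≤ a := norm_nonneg _
  have hγ : 0 ≤ γ := norm_nonneg _
  -- `C` dominates the coefficients of `‖h₀‖` and `‖d‖` in the error, and also `‖B‖‖A‖`. The three
  -- bounds on `η` serve to estimate `‖h‖`, to absorb `‖d‖` through `η * C ≤ 1 / 2`, and to bring
  -- the final error below `ε`.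
  set C := b + b * (γ + 1) + b * a + 1 with hC
  have hC1 : 1 ≤ C := by
    have : 0 ≤ b + b * (γ + 1) + b * a := by positivity
    linarith
  refine ⟨min 1 (min (1 / (2 * C)) (ε / (C * (2 * C + 2)))), by positivity, ?_⟩
  set η := min 1 (min (1 / (2 * C)) (ε / (C * (2 * C + 2)))) with hη
  have hη0 : 0 < η := by positivity
  have hη1 : η ≤ 1 := min_le_left _ _
  have hη2 : η * C ≤ 1 / 2 := by
    have : η ≤ 1 / (2 * C) := (min_le_right _ _).trans (min_le_left _ _)
    rw [le_div_iff₀ (by positivity)] at this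
    linarith
  have hη3 : η * C * (2 * C + 2) ≤ ε := by
    have : η ≤ ε / (C * (2 * C + 2)) := (min_le_right _ _).trans (min_le_right _ _)
    rw [le_div_iff₀ (by positivity)] at this
    linarith
  intro A' hA' d h₀ h hlin hzero
  have hA : ‖A h‖ ≤ η * ‖h‖ := by simpa [hzero] using hA' h
  have hh : ‖h‖ ≤ ‖h₀‖ + (γ + 1) * ‖d‖ := by
    have e1 : h = h₀ + Γ d + (h - h₀ - Γ d) := by abel
    have e2 : ‖h‖ ≤ ‖h₀‖ + ‖Γ d‖ + ‖h - h₀ - Γ d‖ := by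
      conv_lhs => rw [e1]
      exact norm_add₃_le
    have e3 : ‖Γ d‖ ≤ γ * ‖d‖ := Γ.le_opNorm d
    have e4 : η * ‖d‖ ≤ 1 * ‖d‖ := by gcongr
    linarith
  have hid : d + B (A h₀) = B (A h) - B (A (h - h₀ - Γ d)) := by
    simp only [map_sub, hB]
    abel
  have hmain : ‖d + B (A h₀)‖ ≤ η * C * (‖h₀‖ + ‖d‖) := by
    have e1 : ‖B (A h)‖ ≤ b * (η * (‖h₀‖ + (γ + 1) * ‖d‖)) :=
      (B.le_opNorm _).trans (by gcongr; exact hA.trans (by gcongr))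
    have e2 : ‖B (A (h - h₀ - Γ d))‖ ≤ b * (a * (η * ‖d‖)) :=
      (B.le_opNorm _).trans (by gcongr; exact (A.le_opNorm _).trans (by gcongr))
    have e3 := norm_sub_le (B (A h)) (B (A (h - h₀ - Γ d)))
    rw [← hid] at e3
    have e4 : η * C * (‖h₀‖ + ‖d‖) - (b * (η * (‖h₀‖ + (γ + 1) * ‖d‖)) + b * (a * (η * ‖d‖))) =
        η * ((b * (γ + 1) + b * a + 1) * ‖h₀‖ + (b + 1) * ‖d‖) := by
      rw [hC]; ring
    have e5 : 0 ≤ η * ((b * (γ + 1) + b * a + 1) * ‖h₀‖ + (b + 1) * ‖d‖) := by positivity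
    linarith
  -- Absorbing half of `‖d‖` gives an a priori bound by `‖h₀‖`, which is then fed back into `hmain`.
  have hd : ‖d‖ ≤ (2 * C + 1) * ‖h₀‖ := by
    have e1 : ‖d‖ ≤ ‖d + B (A h₀)‖ + ‖B (A h₀)‖ := by
      simpa using norm_sub_le (d + B (A h₀)) (B (A h₀))
    have e2 : ‖B (A h₀)‖ ≤ b * (a * ‖h₀‖) :=
      (B.le_opNorm _).trans (by gcongr; exact A.le_opNorm _)
    have e3 : b * (a * ‖h₀‖) ≤ C * ‖h₀‖ := by
      rw [← mul_assoc]
      gcongr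
      have : 0 ≤ b + b * (γ + 1) := by positivity
      linarith
    have e4 : η * C * (‖h₀‖ + ‖d‖) ≤ 1 / 2 * (‖h₀‖ + ‖d‖) := by gcongr
    linarith
  calc ‖d + B (A h₀)‖ ≤ η * C * (‖h₀‖ + (2 * C + 1) * ‖h₀‖) := hmain.trans (by gcongr)
    _ = η * C * (2 * C + 2) * ‖h₀‖ := by ring
    _ ≤ ε * ‖h₀‖ := by gcongr

theorem exists_norm_add_le_of_approx_mulVec {ι : Type*} [Fintype ι] {p : ℕ}
    {L : Matrix (Fin p) ι ℝ} {Γ : Matrix ι (Fin p) ℝ} (hL : IsUnit (L * Γ).det) {ε : ℝ}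
    (hε : 0 < ε) :
    ∃ η > 0, ∀ L' : Matrix (Fin p) ι ℝ, (∀ k a, |L' k a - L k a| < η) →
      ∀ (d : Vec p) (h₀ h : ι → ℝ), (∀ a, |h a - h₀ a - (Γ *ᵥ d.ofLp) a| ≤ η * ‖d‖) →
        L' *ᵥ h = 0 → ‖d + WithLp.toLp 2 (((L * Γ)⁻¹ * L) *ᵥ h₀)‖ ≤ ε * ‖h₀‖ := by
  let eV := EuclideanSpace.equiv (Fin p) ℝ
  obtain ⟨η, hη, hmain⟩ := exists_norm_add_le_of_approx_linear
    (LinearMap.toContinuousLinearMap L.mulVecLin)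
    ((LinearMap.toContinuousLinearMap Γ.mulVecLin).comp eV.toContinuousLinearMap)
    (eV.symm.toContinuousLinearMap.comp (LinearMap.toContinuousLinearMap (L * Γ)⁻¹.mulVecLin))
    (fun d => by
      apply eV.injective
      simp [Matrix.mulVec_mulVec, Matrix.nonsing_inv_mul _ hL]) hε
  -- Summing over a row turns entrywise closeness into closeness as operators for the sup norm, at
  -- the cost of the factor `card ι`.
  refine ⟨min η (η / (Fintype.card ι + 1)), by positivity, fun L' hL' d h₀ h hlin hzero => ?_⟩
  have := hmain (fun v => L' *ᵥ v) (fun v => ?_) d h₀ h ?_ hzero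
  · simpa [Matrix.mulVec_mulVec, eV] using this
  · refine (pi_norm_le_iff_of_nonneg (by positivity)).2 fun k => ?_
    simp only [LinearMap.coe_toContinuousLinearMap', Matrix.mulVecLin_apply, Pi.sub_apply,
      Matrix.mulVec, dotProduct, ← Finset.sum_sub_distrib, ← sub_mul, Real.norm_eq_abs]
    calc |∑ a, (L k a - L' k a) * v a| ≤ ∑ a, |(L k a - L' k a) * v a| :=
          Finset.abs_sum_le_sum_abs _ _
      _ ≤ ∑ _a : ι, η / (Fintype.card ι + 1) * ‖v‖ := Finset.sum_le_sum fun a _ => by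
          rw [abs_mul, abs_sub_comm]
          gcongr
          · exact (hL' k a).le.trans (min_le_right _ _)
          · exact norm_le_pi_norm v a
      _ = Fintype.card ι * (η / (Fintype.card ι + 1)) * ‖v‖ := by simp [mul_assoc]
      _ ≤ η * ‖v‖ := by
          gcongr
          rw [mul_div_assoc', div_le_iff₀ (by positivity)]
          nlinarith
  · refine (pi_norm_le_iff_of_nonneg (by positivity)).2 fun a => (hlin a).trans ?_
    gcongr
    exact min_le_left _ _

end Normality


/-! ### M-estimators built on the augmented moments -/

section MEstimators

open scoped RealInnerProductSpace

variable {𝒳 : Type*} [MeasurableSpace 𝒳] {m p : ℕ} {μ : Measure 𝒳} {g : 𝒳 → Vec p → Vec m}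

theorem VM_eq_sandwich (θ : Vec p) (L : Matrix (Fin p) (AugIdx m p) ℝ) :
    VM μ g θ L = (L * Gam μ g θ)⁻¹ * L * Sig μ g θ * ((L * Gam μ g θ)⁻¹ * L)ᵀ := by
  rw [VM, Matrix.transpose_mul (L * Gam μ g θ)⁻¹ L, Matrix.transpose_nonsing_inv,
    Matrix.mul_assoc _ Lᵀ]

/-- With `Λ* = Γ'Σ⁻¹` the middle factor `Λ*ΣΛ*'` equals `Λ*Γ`, which is symmetric, so the sandwich
collapses to its inverse. -/
theorem VM_LamStar (θ : Vec p) (hS : (Sig μ g θ).PosDef)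
    (hL : IsUnit (LamStar μ g θ * Gam μ g θ).det) :
    VM μ g θ (LamStar μ g θ) = VME μ g θ := by
  have hSu := (Matrix.isUnit_iff_isUnit_det _).1 hS.isUnit
  have hSt : (Sig μ g θ)ᵀ = Sig μ g θ := by
    simpa [IsHermitian, conjTranspose_eq_transpose_of_trivial] using hS.isHermitian
  have hNt : (LamStar μ g θ * Gam μ g θ)ᵀ = LamStar μ g θ * Gam μ g θ := by
    rw [LamStar, Matrix.transpose_mul, Matrix.transpose_mul, Matrix.transpose_nonsing_inv, hSt,
      Matrix.transpose_transpose, Matrix.mul_assoc]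
  have hLt : (LamStar μ g θ)ᵀ = (Sig μ g θ)⁻¹ * Gam μ g θ := by
    rw [LamStar, Matrix.transpose_mul, Matrix.transpose_nonsing_inv, hSt,
      Matrix.transpose_transpose]
  have hmid : LamStar μ g θ * Sig μ g θ * (LamStar μ g θ)ᵀ = LamStar μ g θ * Gam μ g θ := by
    rw [hLt, Matrix.mul_assoc, Matrix.mul_nonsing_inv_cancel_left _ _ hSu]
  calc VM μ g θ (LamStar μ g θ)
      = (LamStar μ g θ * Gam μ g θ)⁻¹ * (LamStar μ g θ * Sig μ g θ * (LamStar μ g θ)ᵀ) *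
          (LamStar μ g θ * Gam μ g θ)⁻¹ := by
        rw [VM, hNt]; simp only [Matrix.mul_assoc]
    _ = (LamStar μ g θ * Gam μ g θ)⁻¹ := by
        rw [hmid, Matrix.nonsing_inv_mul _ hL, Matrix.one_mul]
    _ = VME μ g θ := rfl

variable {Ω : Type*} [MeasurableSpace Ω] {P : Measure Ω} [IsProbabilityMeasure μ]
  {X : ℕ → Ω → 𝒳} {W : Matrix (Fin m) (Fin m) ℝ} {Θ : Set (Vec p)} {θW : Vec p}

theorem Regular.posSemidef_VM (h : Regular P μ X g W Θ θW) (L : Matrix (Fin p) (AugIdx m p) ℝ) :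
    (VM μ g θW L).PosSemidef := by
  rw [VM_eq_sandwich]
  simpa [conjTranspose_eq_transpose_of_trivial] using
    h.posSemidef_Sig.mul_mul_conjTranspose_same ((L * Gam μ g θW)⁻¹ * L)

theorem Regular.psiTilde_integral_eq_zero (h : Regular P μ X g W Θ θW) (a : AugIdx m p) :
    ∫ x, psiTilde μ g θW x θW a ∂μ = 0 :=
  (h.psiTildePop_apply h.pseudoTrue.1 a).trans (sub_self _)

theorem Regular.memLp_psiTilde (h : Regular P μ X g W Θ θW) (a : AugIdx m p) :
    MemLp (fun x => psiTilde μ g θW x θW a) 2 μ :=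
  (h.memLp_psi a).sub (memLp_const _)

variable [IsProbabilityMeasure P]

theorem Regular.sqrt_smul_norm_psiTildeBar_tight (h : Regular P μ X g W Θ θW) {e : ENNReal}
    (he : 0 < e) :
    ∃ M > 0, ∀ n : ℕ, P {ω | M ≤ √n * ‖psiTildeBar μ g θW X n ω θW‖} ≤ e := by
  have hc : 0 < e / (Fintype.card (AugIdx m p) + 1 : ℕ) :=
    ENNReal.div_pos he.ne' (ENNReal.natCast_ne_top _)
  have hcoord : ∀ a : AugIdx m p, ∃ M > 0, ∀ n : ℕ,
      P {ω | M ≤ √n * |psiTildeBar μ g θW X n ω θW a|} ≤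
        e / (Fintype.card (AugIdx m p) + 1 : ℕ) := fun a => by
    simp only [psiTildeBar_apply]
    exact exists_forall_measure_le_sqrt_mul_avg h.indep h.law (h.memLp_psiTilde a)
      (h.psiTilde_integral_eq_zero a) hc
  choose M hM hMe using hcoord
  -- If every coordinate stays below its `M a`, the sup norm is at most the sum; the extra `1` makes
  -- this contradict `T ≤ ...` and keeps `T` positive.
  set T := 1 + ∑ a, M a with hT
  have hsum : 0 ≤ ∑ a, M a := Finset.sum_nonneg fun a _ => (hM a).le
  refine ⟨T, by linarith, fun n => ?_⟩
  have hsub : {ω | T ≤ √n * ‖psiTildeBar μ g θW X n ω θW‖} ⊆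
      ⋃ a, {ω | M a ≤ √n * |psiTildeBar μ g θW X n ω θW a|} := fun ω hω => by
    by_contra hcon
    simp only [Set.mem_iUnion, Set.mem_ofPred_eq, not_exists, not_le] at hcon hω
    have hb : ‖√n • psiTildeBar μ g θW X n ω θW‖ ≤ ∑ a, M a := by
      refine (pi_norm_le_iff_of_nonneg hsum).2 fun a => ?_
      rw [Pi.smul_apply, norm_smul, Real.norm_of_nonneg (Real.sqrt_nonneg _)]
      exact (hcon a).le.trans
        (Finset.single_le_sum (f := M) (fun a _ => (hM a).le) (Finset.mem_univ a))
    rw [norm_smul, Real.norm_of_nonneg (Real.sqrt_nonneg _)] at hb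
    linarith
  calc P {ω | T ≤ √n * ‖psiTildeBar μ g θW X n ω θW‖}
      ≤ ∑ a, P {ω | M a ≤ √n * |psiTildeBar μ g θW X n ω θW a|} :=
        (measure_mono hsub).trans (measure_iUnion_fintype_le _ _)
    _ ≤ ∑ _a : AugIdx m p, e / (Fintype.card (AugIdx m p) + 1 : ℕ) :=
        Finset.sum_le_sum fun a _ => hMe a n
    _ = Fintype.card (AugIdx m p) * (e / (Fintype.card (AugIdx m p) + 1 : ℕ)) := by
        rw [Finset.sum_const, nsmul_eq_mul, Finset.card_univ]
    _ ≤ (Fintype.card (AugIdx m p) + 1 : ℕ) * (e / (Fintype.card (AugIdx m p) + 1 : ℕ)) := by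
        gcongr
        exact Nat.le_succ _
    _ = e := ENNReal.mul_div_cancel (by simp) (ENNReal.natCast_ne_top _)

/-- Asymptotic normality of the influence-function representation of an M-estimator. -/
theorem Regular.tendstoInDistribution_influence (h : Regular P μ X g W Θ θW)
    (L : Matrix (Fin p) (AugIdx m p) ℝ) :
    TendstoInDistribution (fun (n : ℕ) ω => (√n)⁻¹ • ∑ i ∈ Finset.range n,
        -WithLp.toLp 2 (((L * Gam μ g θW)⁻¹ * L) *ᵥ psiTilde μ g θW (X i ω) θW)) atTop
      (id : Vec p → Vec p) (fun _ => P) (multivariateGaussian 0 (VM μ g θW L)) := by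
  set K := (L * Gam μ g θW)⁻¹ * L with hK
  have hinner : ∀ (t : Vec p) (x : 𝒳), ⟪-WithLp.toLp 2 (K *ᵥ psiTilde μ g θW x θW), t⟫ =
      (-(Kᵀ *ᵥ t.ofLp)) ⬝ᵥ psiTilde μ g θW x θW := fun t x => by
    rw [inner_neg_left, EuclideanSpace.inner_eq_star_dotProduct, star_trivial, neg_dotProduct,
      Matrix.dotProduct_mulVec, Matrix.mulVec_transpose]
  have hmem : ∀ w : AugIdx m p → ℝ, MemLp (fun x => w ⬝ᵥ psiTilde μ g θW x θW) 2 μ := fun w => by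
    simpa [dotProduct] using
      memLp_finsetSum Finset.univ fun a _ => (h.memLp_psiTilde a).const_mul (w a)
  refine tendstoInDistribution_inv_sqrt_smul_sum h.indep h.law
    (f := fun x => -WithLp.toLp 2 (K *ᵥ psiTilde μ g θW x θW)) ?_ (fun t => ?_) (fun t => ?_)
    (h.posSemidef_VM L) fun t => ?_
  · refine AEMeasurable.neg ((WithLp.measurable_toLp 2 _).comp_aemeasurable
      (aemeasurable_pi_lambda _ fun k => ?_))
    exact (hmem fun a => K k a).aestronglyMeasurable.aemeasurable
  · simpa only [hinner] using hmem _
  · simp only [hinner, dotProduct]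
    rw [integral_finsetSum _ fun a _ =>
      ((h.memLp_psiTilde a).const_mul _).integrable one_le_two]
    exact Finset.sum_eq_zero fun a _ => by
      rw [integral_const_mul, h.psiTilde_integral_eq_zero, mul_zero]
  -- Centring leaves the variance unchanged, and the quadratic form of `Σ` at `K't` is that of `K Σ
  -- K'` at `t`.
  · set w := -(Kᵀ *ᵥ t.ofLp) with hw
    have hshift : (fun x => w ⬝ᵥ psiTilde μ g θW x θW) =
        fun x => w ⬝ᵥ psi g x θW - w ⬝ᵥ psiPop μ g θW := by
      ext x; simp [psiTilde, dotProduct_sub]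
    have hmeas : AEStronglyMeasurable (fun x => w ⬝ᵥ psi g x θW) μ := by
      simp only [dotProduct]
      exact Finset.aestronglyMeasurable_fun_sum _ fun a _ =>
        ((h.memLp_psi a).const_mul _).aestronglyMeasurable
    simp only [hinner]
    rw [← hw, hshift, variance_sub_const hmeas, h.variance_dotProduct_psi, VM_eq_sandwich, ← hK,
      hw, Matrix.mulVec_neg, neg_dotProduct, dotProduct_neg, neg_neg, ← Matrix.mulVec_mulVec,
      ← Matrix.mulVec_mulVec, Matrix.mulVec_transpose, ← Matrix.dotProduct_mulVec]

/-- Asymptotic normality of M-estimators. -/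
theorem IsMEstimator.tendstoInDistribution (h : Regular P μ X g W Θ θW)
    {L : Matrix (Fin p) (AugIdx m p) ℝ} (hL : Admissible μ g Θ θW L)
    {Lhat : ℕ → Ω → Matrix (Fin p) (AugIdx m p) ℝ} {θhat : ℕ → Ω → Vec p}
    (hM : IsMEstimator P μ X g Θ θW L Lhat θhat) :
    TendstoInDistribution (fun (n : ℕ) ω => √n • (θhat n ω - θW)) atTop
      (id : Vec p → Vec p) (fun _ => P) (multivariateGaussian 0 (VM μ g θW L)) := by
  -- Slutsky: it remains to show that the scaled estimation error differs from the influence sum by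
  -- a term tending to zero in probability.
  refine tendstoInDistribution_of_tendstoInMeasure_sub _ _
    (h.tendstoInDistribution_influence L) ?_
    fun n => ((hM.aemeasurable n).sub_const θW).const_smul (√n)
  refine tendstoInMeasure_zero_of_wpa_norm_le
    (ζ := fun n ω => √n * ‖psiTildeBar μ g θW X n ω θW‖) (fun δ hδ => ?_)
    fun e he => h.sqrt_smul_norm_psiTildeBar_tight he
  -- The tolerance `η` is chosen from `δ`, then the radius `r` from `η`; consistency places the
  -- estimator within `r` of `θW`, where the linearization holds.
  obtain ⟨η, hη, hb⟩ := exists_norm_add_le_of_approx_mulVec hL.nonsing hδ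
  obtain ⟨r, hr, hlin⟩ := h.wpa_psiTildeBar_linearize hη
  have hsol : Wpa P fun n ω => θhat n ω ∈ Θ ∧
      Lhat n ω *ᵥ psiTildeBar μ g θW X n ω (θhat n ω) = 0 := hM.solves
  refine ((hsol.and (hM.wpa_near hη)).and ((hM.wpa_dist_lt h hL hr).and hlin)).mono ?_
  rintro n ω ⟨⟨⟨-, hzero⟩, hnear⟩, hd, hl⟩
  have key := hb _ hnear (θhat n ω - θW) (psiTildeBar μ g θW X n ω θW) _
    (hl (θhat n ω) hd) hzero
  have hsqrt : (√(n : ℝ))⁻¹ = √n * (n : ℝ)⁻¹ := by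
    rcases Nat.eq_zero_or_pos n with rfl | hn
    · simp
    · have : (0 : ℝ) < n := by positivity
      field_simp
      rw [Real.sq_sqrt this.le]
  set K := (L * Gam μ g θW)⁻¹ * L with hK
  have hrepr : (√(n : ℝ))⁻¹ • ∑ i ∈ Finset.range n,
        -WithLp.toLp 2 (K *ᵥ psiTilde μ g θW (X i ω) θW) =
      -(√n • WithLp.toLp 2 (K *ᵥ psiTildeBar μ g θW X n ω θW)) := by
    rw [psiTildeBar, hsqrt, Finset.sum_neg_distrib, smul_neg, mul_smul, Matrix.mulVec_smul,
      Matrix.mulVec_sum, WithLp.toLp_smul, WithLp.toLp_sum]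
  have hdiff : ((fun (n : ℕ) ω => √n • (θhat n ω - θW)) - fun (n : ℕ) ω => (√n)⁻¹ •
        ∑ i ∈ Finset.range n, -WithLp.toLp 2 (K *ᵥ psiTilde μ g θW (X i ω) θW)) n ω =
      √n • (θhat n ω - θW + WithLp.toLp 2 (K *ᵥ psiTildeBar μ g θW X n ω θW)) := by
    rw [Pi.sub_apply, Pi.sub_apply, hrepr, sub_neg_eq_add, smul_add]
  rw [hdiff, norm_smul, Real.norm_of_nonneg (Real.sqrt_nonneg _), mul_left_comm]
  gcongr

end MEstimators

end MisspecGMM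

open MisspecGMM in
theorem corollary1 {Ω 𝒳 : Type*} [MeasurableSpace Ω] [MeasurableSpace 𝒳] {m p : ℕ}
    (P : Measure Ω) [IsProbabilityMeasure P] (μ : Measure 𝒳) [IsProbabilityMeasure μ]
    (X : ℕ → Ω → 𝒳) (g : 𝒳 → MisspecGMM.Vec p → MisspecGMM.Vec m)
    (W : Matrix (Fin m) (Fin m) ℝ) (Θ : Set (MisspecGMM.Vec p)) (θW : MisspecGMM.Vec p)
    (hreg : MisspecGMM.Regular P μ X g W Θ θW)
    (hSig : IsUnit (MisspecGMM.Sig μ g θW).det)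
    (hLam : MisspecGMM.Admissible μ g Θ θW (MisspecGMM.LamStar μ g θW)) :
    -- the limiting covariance matrix is a genuine one
    (MisspecGMM.VME μ g θW).PosDef ∧
    -- asymptotic normality of the misspecification-efficient estimator
    (∀ (Lhat : ℕ → Ω → Matrix (Fin p) (MisspecGMM.AugIdx m p) ℝ)
        (θhat : ℕ → Ω → MisspecGMM.Vec p),
      MisspecGMM.IsMEstimator P μ X g Θ θW (MisspecGMM.LamStar μ g θW) Lhat θhat →
      TendstoInDistribution (fun (n : ℕ) ω => Real.sqrt n • (θhat n ω - θW)) atTop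
        (id : MisspecGMM.Vec p → MisspecGMM.Vec p) (fun _ => P)
        (multivariateGaussian 0 (MisspecGMM.VME μ g θW))) ∧
    -- efficiency among all admissible choices of `Λ`
    (∀ L : Matrix (Fin p) (MisspecGMM.AugIdx m p) ℝ, MisspecGMM.Admissible μ g Θ θW L →
      (MisspecGMM.VM μ g θW L - MisspecGMM.VME μ g θW).PosSemidef) ∧
    -- in particular, the GMM estimator is no more efficient
    (IsUnit (MisspecGMM.AGmm μ g W θW * MisspecGMM.Gam μ g θW).det →
      (MisspecGMM.VGMM μ g W θW - MisspecGMM.VME μ g θW).PosSemidef) ∧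
    -- the partitioned form of the variance, with the matrices inverted in it nonsingular
    IsUnit (MisspecGMM.Sig11 μ g θW).det ∧
    IsUnit (MisspecGMM.Sig22dot1 μ g θW).det ∧
    MisspecGMM.VME μ g θW =
      ((MisspecGMM.GPop μ g θW)ᵀ * (MisspecGMM.Sig11 μ g θW)⁻¹ * MisspecGMM.GPop μ g θW +
        (MisspecGMM.FG μ g θW)ᵀ * (MisspecGMM.Sig22dot1 μ g θW)⁻¹ *
          MisspecGMM.FG μ g θW)⁻¹ := by
  have hS := hreg.posDef_Sig hSig
  have hSt : (Sig μ g θW)ᵀ = Sig μ g θW := by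
    simpa [IsHermitian, conjTranspose_eq_transpose_of_trivial] using hS.isHermitian
  have hblk : Sig μ g θW =
      fromBlocks (Sig11 μ g θW) (Sig12 μ g θW) (Sig21 μ g θW) (Sig22 μ g θW) :=
    (fromBlocks_toBlocks _).symm
  have h11 : (Sig11 μ g θW).PosDef := hS.submatrix Sum.inl_injective
  have h11u := (Matrix.isUnit_iff_isUnit_det _).1 h11.isUnit
  have h11t : (Sig11 μ g θW)ᵀ = Sig11 μ g θW := by
    simpa [IsHermitian, conjTranspose_eq_transpose_of_trivial] using h11.isHermitian
  have h12 : (Sig12 μ g θW)ᵀ = Sig21 μ g θW := by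
    ext a b
    exact congrFun (congrFun hSt (Sum.inr a)) (Sum.inl b)
  have h22 : IsUnit (Sig22dot1 μ g θW).det :=
    isUnit_det_schurComplement h11u (hblk ▸ hSig)
  -- The variance comparisons are pure Gauss–Markov: they use nonsingularity of `ΛΓ` but not
  -- identification.
  refine ⟨(posDef_transpose_mul_inv_mul hS hLam.nonsing).inv, fun Lhat θhat hM => ?_,
    fun L hL => posSemidef_sandwich_sub hS hL.nonsing, fun hA => posSemidef_sandwich_sub hS hA,
    h11u, h22, ?_⟩
  · have := hM.tendstoInDistribution hreg hLam
    simp only [VM_LamStar θW hS hLam.nonsing] at this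
    exact this
  · rw [VME, hblk, Gam, fromRows_transpose_mul_inv_fromBlocks_mul h11u h11t h12 h22]
    rfl
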